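/- Let $d\ge 1$ be an integer and $\mathbb{R}_+=[0,\infty)$. Let $\mathcal{A}$ be a separable $C^*$-algebra and let $E$ be a countably generated Hilbert $\mathcal{A}$-module. Let $V=\{V_t\}_{t\in\mathbb{R}_+^d}$ be a strictly continuous semigroup of isometries on $E$: each $V_t$ is an adjointable operator on $E$ with $V_t^*V_t=1$, $V_0=1$, $V_{s+t}=V_sV_t$ for all $s,t\in\mathbb{R}_+^d$, and $t\mapsto V_t\xi$ and $t\mapsto V_t^*\xi$ are norm continuous for every $\xi\in E$. Let $e_1,\dots,e_d$ be the standard basis of $\mathbb{R}^d$. Suppose that $V$ is doubly commuting, i.e. $V_{te_i}V_{se_j}^*=V_{se_j}^*V_{te_i}$ for all $i\ne j$ and $s,t\in\mathbb{R}_+$, and strongly pure, i.e. for every $i$, $V_{te_i}V_{te_i}^*\to 0$ in the strict topology as $t\to\infty$. Let $S=\{S_t\}_{t\in\mathbb{R}_+^d}$ be the shift semigroup on $L^2(\mathbb{R}_+^d)$, $$S_tf(x)=\begin{cases}f(x-t)&\text{if }x-t\in\mathbb{R}_+^d,\\0&\text{otherwise.}\end{cases}$$ Below, $\otimes$ is the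 external tensor product of the Hilbert space $L^2(\mathbb{R}_+^d)$ with a Hilbert $\mathcal{A}$-module. 1. There exist a Hilbert $\mathcal{A}$-module $K$ and a unitary $U:L^2(\mathbb{R}_+^d)\otimes K\to E$ such that $U(S_t\otimes 1)U^*=V_t$ for every $t\in\mathbb{R}_+^d$. 2. More precisely, let $z\in\mathbb{C}^d$ with $\operatorname{Re} z_i>0$ for all $i$. With $\langle z,t\rangle=\sum_{i=1}^d z_it_i$, put $$K_z=\{\xi\in E: V_t^*\xi=e^{-\langle z,t\rangle}\xi\text{ for all }t\in\mathbb{R}_+^d\},\qquad f_z(x)=\Big(2^d\prod_{i=1}^d\operatorname{Re} z_i\Big)^{1/2}e^{-\langle z,x\rangle}\in L^2(\mathbb{R}_+^d).$$ Then there is a unitary $U:E\to L^2(\mathbb{R}_+^d)\otimes K_z$ such that $UV_t=(S_t\otimes 1)U$ for every $t\in\mathbb{R}_+^d$ and $U\xi=f_z\otimes\xi$ for every $\xi\in K_z$. -/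

import Mathlib

open MeasureTheory Filter Topology
open scoped NNReal ENNReal TensorProduct InnerProductSpace

universe u v

noncomputable section

/-!
Hilbert modules over a `C⋆`-algebra `A` are complete normed spaces with Mathlib's class
`CStarModule A E`. In that class the algebra acts by `a • x`, and the `A`-valued inner product
is linear in the second variable with `⟪x, a • y⟫ = a * ⟪x, y⟫` (right Hilbert modules over `A` are
the objects of this class over the opposite algebra).
-/

namespace HilbertMod

/-! ### Elementary facts on Hilbert modules -/

section Basic

variable {A E : Type*} [NonUnitalCStarAlgebra A] [PartialOrder A]
  [NormedAddCommGroup E] [NormedSpace ℂ E] [SMul A E] [CStarModule A E]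

variable (A) in
theorem ext_inner_left {x y : E} (h : ∀ w : E, inner A w x = inner A w y) : x = y := by
  have h1 : inner A (x - y) (x - y) = 0 := by
    rw [CStarModule.inner_sub_right, h, sub_self]
  exact sub_eq_zero.mp (CStarModule.inner_self.mp h1)

variable (A) in
theorem ext_inner_right {x y : E} (h : ∀ w : E, inner A x w = inner A y w) : x = y := by
  refine ext_inner_left A fun w => ?_
  rw [← CStarModule.star_inner x w, h, CStarModule.star_inner]

theorem act_add (a : A) (x y : E) : a • (x + y) = a • x + a • y :=
  ext_inner_left A fun w => by simp [mul_add]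

theorem act_complex_smul (a : A) (c : ℂ) (x : E) : a • (c • x) = c • (a • x) :=
  ext_inner_left A fun w => by simp [mul_smul_comm]

theorem norm_act_le (a : A) (x : E) : ‖a • x‖ ≤ ‖a‖ * ‖x‖ := by
  have h : ‖a • x‖ ^ 2 ≤ (‖a‖ * ‖x‖) ^ 2 := by
    rw [CStarModule.norm_sq_eq A, CStarModule.inner_op_smul_right,
      CStarModule.inner_op_smul_left, mul_pow, CStarModule.norm_sq_eq A (x := x)]
    calc ‖a * (inner A x x * star a)‖ ≤ ‖a‖ * (‖inner A x x‖ * ‖star a‖) :=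
          (norm_mul_le _ _).trans
            (mul_le_mul_of_nonneg_left (norm_mul_le _ _) (norm_nonneg _))
      _ = ‖a‖ ^ 2 * ‖inner A x x‖ := by rw [norm_star]; ring
  exact (sq_le_sq₀ (norm_nonneg _) (by positivity)).mp h

variable (E) in
/-- The action of an element of `A` as a complex linear map. -/
def actLinear (a : A) : E →ₗ[ℂ] E where
  toFun x := a • x
  map_add' := act_add a
  map_smul' c x := act_complex_smul a c x

variable (A E) in
theorem uniformContinuousConstSMul : UniformContinuousConstSMul A E where
  uniformContinuous_const_smul a :=
    AddMonoidHomClass.uniformContinuous_of_bound (actLinear E a) ‖a‖ (norm_act_le a)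

/-- `E` is countably generated: for some countable set `s`, the linear span of the elements
`a • x` with `a ∈ A` and `x ∈ s` is dense in `E`. -/
def CountablyGenerated (A E : Type*) [NormedAddCommGroup E] [NormedSpace ℂ E] [SMul A E] : Prop :=
  ∃ s : Set E, s.Countable ∧
    Dense (Submodule.span ℂ {y : E | ∃ a : A, ∃ x ∈ s, y = a • x} : Set E)

end Basic

/-! ### Adjointable operators and the strict topology -/

/-- An adjointable operator `E → F` between Hilbert modules: a map `T` together with the (unique)
map `T⋆` such that `⟪T x, y⟫ = ⟪x, T⋆ y⟫` for all `x` and `y`. -/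
structure Adjointable (A E F : Type*) [Inner A E] [Inner A F] where
  toFun : E → F
  adjFun : F → E
  inner_toFun_left : ∀ x y, inner A (toFun x) y = inner A x (adjFun y)

namespace Adjointable

instance {A E F : Type*} [Inner A E] [Inner A F] :
    CoeFun (Adjointable A E F) (fun _ => E → F) := ⟨Adjointable.toFun⟩

variable {A E F G : Type*} [NonUnitalCStarAlgebra A] [PartialOrder A]
  [NormedAddCommGroup E] [NormedSpace ℂ E] [SMul A E] [CStarModule A E]
  [NormedAddCommGroup F] [NormedSpace ℂ F] [SMul A F] [CStarModule A F]
  [NormedAddCommGroup G] [NormedSpace ℂ G] [SMul A G] [CStarModule A G]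

theorem inner_toFun_right (T : Adjointable A E F) (x : E) (y : F) :
    inner A y (T x) = inner A (T.adjFun y) x := by
  rw [← CStarModule.star_inner (T x) y, T.inner_toFun_left, CStarModule.star_inner]

/-- Adjointable operators are equal as soon as they are equal as maps. -/
theorem ext {S T : Adjointable A E F} (h : ∀ x, S x = T x) : S = T := by
  have h1 : S.toFun = T.toFun := funext h
  have h2 : S.adjFun = T.adjFun := funext fun y => ext_inner_left A fun w => by
    rw [← S.inner_toFun_left, ← T.inner_toFun_left, h]
  cases S; cases T; simp only at h1 h2; subst h1; subst h2; rfl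

/-- The adjoint operator. -/
def adjoint (T : Adjointable A E F) : Adjointable A F E where
  toFun := T.adjFun
  adjFun := T.toFun
  inner_toFun_left y x := (T.inner_toFun_right x y).symm

/-- Composition of adjointable operators. -/
def comp (S : Adjointable A F G) (T : Adjointable A E F) : Adjointable A E G where
  toFun x := S (T x)
  adjFun y := T.adjFun (S.adjFun y)
  inner_toFun_left x y := by rw [S.inner_toFun_left, T.inner_toFun_left]

instance : One (Adjointable A E E) := ⟨⟨id, id, fun _ _ => rfl⟩⟩

instance : Zero (Adjointable A E F) := ⟨⟨fun _ => 0, fun _ => 0, fun _ _ => by simp⟩⟩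

instance : Mul (Adjointable A E E) := ⟨comp⟩

instance : Star (Adjointable A E E) := ⟨adjoint⟩

/-- The strict topology: the topology of pointwise norm convergence of the operators and
of their adjoints, `Tᵢ → T` iff `Tᵢ x → T x` and `Tᵢ⋆ y → T⋆ y` for all `x` and `y`. -/
instance strictTopology : TopologicalSpace (Adjointable A E F) :=
  TopologicalSpace.induced
    (fun T => ((T.toFun, T.adjFun) : (E → F) × (F → E))) inferInstance

/-- `T` is unitary: `T⋆ T = 1` and `T T⋆ = 1`. -/
def IsUnitary (T : Adjointable A E F) : Prop :=
  T.adjoint.comp T = 1 ∧ T.comp T.adjoint = 1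

theorem map_add (T : Adjointable A E F) (x y : E) : T (x + y) = T x + T y :=
  ext_inner_left A fun w => by simp [inner_toFun_right]

theorem map_complex_smul (T : Adjointable A E F) (c : ℂ) (x : E) : T (c • x) = c • T x :=
  ext_inner_left A fun w => by simp [inner_toFun_right]

theorem map_act (T : Adjointable A E F) (a : A) (x : E) : T (a • x) = a • T x :=
  ext_inner_left A fun w => by simp [inner_toFun_right]

end Adjointable

/-! ### The completion of a pre-Hilbert module -/

section Completion

variable {A P : Type*} [NonUnitalCStarAlgebra A] [PartialOrder A] [StarOrderedRing A]
  [NormedAddCommGroup P] [NormedSpace ℂ P] [SMul A P] [CStarModule A P]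

open UniformSpace

theorem completion_inner_coe (x y : P) :
    inner A (x : Completion P) (y : Completion P) = inner A x y :=
  (Completion.isDenseInducing_coe.prodMap Completion.isDenseInducing_coe).extend_eq
    (CStarModule.continuous_inner : Continuous fun x : P × P => inner A x.1 x.2) (x, y)

theorem completion_continuous_inner :
    Continuous fun p : Completion P × Completion P => inner A p.1 p.2 := by
  let inner' : P →+ P →+ A :=
    { toFun := fun x => (CStarModule.innerₛₗ x : P →ₗ[ℂ] A).toAddMonoidHom
      map_zero' := by ext x; simp
      map_add' := fun x y => by ext z; simp }
  have : Continuous fun p : P × P => inner' p.1 p.2 := CStarModule.continuous_inner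
  change Continuous
      (((Completion.isDenseInducing_toCompl P).prodMap
        (Completion.isDenseInducing_toCompl P)).extend fun p : P × P => inner' p.1 p.2)
  exact (Completion.isDenseInducing_toCompl P).extend_Z_bilin
    (Completion.isDenseInducing_toCompl P) this

theorem completion_continuous_inner_comp {X : Type*} [TopologicalSpace X]
    {f g : X → Completion P} (hf : Continuous f) (hg : Continuous g) :
    Continuous fun x => inner A (f x) (g x) :=
  (completion_continuous_inner (A := A) (P := P)).comp (hf.prodMk hg)

/-- The completion of a pre-Hilbert module is a Hilbert module: the inner product and the action
of `A` are the continuous extensions of those of the given module. -/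
instance completionCStarModule : CStarModule A (Completion P) where
  inner_add_right {x y z} :=
    Completion.induction_on₃ x y z
      (isClosed_eq (completion_continuous_inner_comp (by fun_prop) (by fun_prop))
        ((completion_continuous_inner_comp (by fun_prop) (by fun_prop)).add
          (completion_continuous_inner_comp (by fun_prop) (by fun_prop))))
      fun a b c => by
        simp only [← Completion.coe_add, completion_inner_coe, CStarModule.inner_add_right]
  inner_self_nonneg {x} :=
    Completion.induction_on x
      (isClosed_le continuous_const (completion_continuous_inner_comp continuous_id continuous_id))
      fun a => by simpa only [completion_inner_coe] using! CStarModule.inner_self_nonneg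
  inner_self {x} := by
    have h : ‖x‖ ^ 2 = ‖inner A x x‖ :=
      Completion.induction_on x
        (isClosed_eq (by fun_prop)
          (completion_continuous_inner_comp continuous_id continuous_id).norm)
        fun a => by rw [completion_inner_coe, Completion.norm_coe, CStarModule.norm_sq_eq A]
    rw [← norm_eq_zero (a := inner A x x), ← h, sq_eq_zero_iff, norm_eq_zero]
  inner_op_smul_right {a x y} := by
    have := uniformContinuousConstSMul A P
    exact Completion.induction_on₂ x y
      (isClosed_eq
        (completion_continuous_inner_comp continuous_fst (continuous_snd.const_smul a))
        (continuous_const.mul (completion_continuous_inner_comp continuous_fst continuous_snd)))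
      fun b c => by
        simp only [← Completion.coe_smul, completion_inner_coe, CStarModule.inner_op_smul_right]
  inner_smul_right_complex {z x y} :=
    Completion.induction_on₂ x y
      (isClosed_eq
        (completion_continuous_inner_comp continuous_fst (continuous_snd.const_smul z))
        ((completion_continuous_inner_comp continuous_fst continuous_snd).const_smul z))
      fun b c => by
        simp only [← Completion.coe_smul, completion_inner_coe,
          CStarModule.inner_smul_right_complex]
  star_inner x y :=
    Completion.induction_on₂ x y
      (isClosed_eq (completion_continuous_inner_comp continuous_fst continuous_snd).star
        (completion_continuous_inner_comp continuous_snd continuous_fst))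
      fun b c => by simp only [completion_inner_coe, CStarModule.star_inner]
  norm_eq_sqrt_norm_inner_self x :=
    Completion.induction_on x
      (isClosed_eq continuous_norm
        (completion_continuous_inner_comp continuous_id continuous_id).norm.sqrt)
      fun a => by
        rw [completion_inner_coe, Completion.norm_coe,
          CStarModule.norm_eq_sqrt_norm_inner_self (A := A)]

end Completion

/-! ### The external tensor product of a Hilbert space and a Hilbert module -/

/-- The algebraic tensor product of a Hilbert space `H` and a Hilbert `A`-module `K`, with
the `A`-valued inner product `⟪h ⊗ k, h' ⊗ k'⟫ = ⟪h, h'⟫ ⟪k, k'⟫` and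
the action `a • (h ⊗ k) = h ⊗ (a • k)`. -/
def PreTensor (_A H K : Type*) [NormedAddCommGroup H] [InnerProductSpace ℂ H]
    [NormedAddCommGroup K] [NormedSpace ℂ K] : Type _ := H ⊗[ℂ] K

namespace PreTensor

section Algebra

variable (A H K : Type*) [NormedAddCommGroup H] [InnerProductSpace ℂ H]
  [NormedAddCommGroup K] [NormedSpace ℂ K]

instance : AddCommGroup (PreTensor A H K) := inferInstanceAs (AddCommGroup (H ⊗[ℂ] K))

instance : Module ℂ (PreTensor A H K) := inferInstanceAs (Module ℂ (H ⊗[ℂ] K))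

end Algebra

/-- The elementary tensor `h ⊗ k` in the algebraic tensor product. -/
def tmul (A : Type*) {H K : Type*} [NormedAddCommGroup H] [InnerProductSpace ℂ H]
    [NormedAddCommGroup K] [NormedSpace ℂ K] (h : H) (k : K) : PreTensor A H K := h ⊗ₜ[ℂ] k

variable {A H K : Type*} [NonUnitalCStarAlgebra A] [PartialOrder A]
  [NormedAddCommGroup H] [InnerProductSpace ℂ H]
  [NormedAddCommGroup K] [NormedSpace ℂ K] [SMul A K] [CStarModule A K]

/-- For fixed `h` and `k`, the linear map `h' ⊗ k' ↦ ⟪h, h'⟫ ⟪k, k'⟫`. -/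
def innerAux (A : Type*) {H K : Type*} [NonUnitalCStarAlgebra A] [PartialOrder A]
    [NormedAddCommGroup H] [InnerProductSpace ℂ H]
    [NormedAddCommGroup K] [NormedSpace ℂ K] [SMul A K] [CStarModule A K]
    (h : H) (k : K) : H ⊗[ℂ] K →ₗ[ℂ] A :=
  TensorProduct.lift (LinearMap.mk₂ ℂ (fun h' k' => (inner ℂ h h') • inner A k k')
    (fun _ _ _ => by rw [inner_add_right, add_smul])
    (fun _ _ _ => by rw [inner_smul_right, mul_smul])
    (fun _ _ _ => by rw [CStarModule.inner_add_right, smul_add])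
    (fun _ _ _ => by rw [CStarModule.inner_smul_right_complex, smul_comm]))

/-- The sesquilinear form with `(h ⊗ k, h' ⊗ k') ↦ ⟪h, h'⟫ ⟪k, k'⟫`. -/
def innerForm (A H K : Type*) [NonUnitalCStarAlgebra A] [PartialOrder A]
    [NormedAddCommGroup H] [InnerProductSpace ℂ H]
    [NormedAddCommGroup K] [NormedSpace ℂ K] [SMul A K] [CStarModule A K] :
    H ⊗[ℂ] K →ₗ⋆[ℂ] H ⊗[ℂ] K →ₗ[ℂ] A :=
  TensorProduct.lift (LinearMap.mk₂'ₛₗ (starRingEnd ℂ) (starRingEnd ℂ)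
    (fun h k => innerAux A h k)
    (fun _ _ _ => TensorProduct.ext' fun _ _ => by simp [innerAux, add_smul])
    (fun _ _ _ => TensorProduct.ext' fun _ _ => by simp [innerAux, mul_smul, smul_comm (inner ℂ _ _)])
    (fun _ _ _ => TensorProduct.ext' fun _ _ => by simp [innerAux])
    (fun _ _ _ => TensorProduct.ext' fun _ _ => by
      simp only [innerAux, TensorProduct.lift.tmul, LinearMap.mk₂_apply, LinearMap.smul_apply,
        CStarModule.inner_smul_left_complex, starRingEnd_apply]
      rw [smul_comm]))

@[simp]
theorem innerForm_tmul (h h' : H) (k k' : K) :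
    innerForm A H K (h ⊗ₜ k) (h' ⊗ₜ k') = (inner ℂ h h') • inner A k k' := rfl

theorem innerForm_star (x y : H ⊗[ℂ] K) :
    star (innerForm A H K x y) = innerForm A H K y x := by
  induction x with
  | zero => simp
  | add x₁ x₂ h₁ h₂ => simp [h₁, h₂]
  | tmul h k =>
    induction y with
    | zero => simp
    | add y₁ y₂ h₁ h₂ => simp [h₁, h₂]
    | tmul h' k' => simp

theorem innerForm_act (a : A) (x y : H ⊗[ℂ] K) :
    innerForm A H K x ((actLinear K a).lTensor H y) = a * innerForm A H K x y := by
  induction x with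
  | zero => simp
  | add x₁ x₂ h₁ h₂ => simp [h₁, h₂, mul_add]
  | tmul h k =>
    induction y with
    | zero => simp
    | add y₁ y₂ h₁ h₂ => simp [h₁, h₂, mul_add]
    | tmul h' k' => simp [actLinear, mul_smul_comm]

theorem exists_orthonormal_sum (x : H ⊗[ℂ] K) :
    ∃ (n : ℕ) (e : Fin n → H) (k : Fin n → K), Orthonormal ℂ e ∧ x = ∑ i, e i ⊗ₜ k i := by
  obtain ⟨H', K', iH', iK', hz⟩ :=
    TensorProduct.exists_finite_submodule_of_setFinite {x} (Set.finite_singleton x)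
  obtain ⟨y, rfl⟩ := Set.singleton_subset_iff.mp hz
  let b := stdOrthonormalBasis ℂ H'
  refine ⟨_, fun i => (b i : H), ?_⟩
  have hb : Orthonormal ℂ fun i => (b i : H) := b.orthonormal.comp_linearIsometry H'.subtypeₗᵢ
  suffices h : ∃ k : Fin (Module.finrank ℂ H') → K,
      TensorProduct.mapIncl H' K' y = ∑ i, (b i : H) ⊗ₜ[ℂ] k i by
    obtain ⟨k, hk⟩ := h
    exact ⟨k, hb, hk⟩
  induction y with
  | zero => exact ⟨0, by simp⟩
  | add y₁ y₂ h₁ h₂ =>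
    obtain ⟨k₁, h₁⟩ := h₁ (by simp)
    obtain ⟨k₂, h₂⟩ := h₂ (by simp)
    exact ⟨k₁ + k₂, by simp [h₁, h₂, TensorProduct.tmul_add, Finset.sum_add_distrib]⟩
  | tmul h k =>
    refine ⟨fun i => b.repr h i • (k : K), ?_⟩
    have hh : (h : H) = ∑ i, b.repr h i • (b i : H) := by
      conv_lhs => rw [← b.sum_repr h]
      simp
    simp only [TensorProduct.mapIncl, TensorProduct.map_tmul, Submodule.coe_subtype,
      TensorProduct.tmul_smul]
    conv_lhs => rw [hh]
    simp [TensorProduct.sum_tmul, TensorProduct.smul_tmul']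

theorem innerForm_orthonormal {n : ℕ} {e : Fin n → H} (he : Orthonormal ℂ e) (k : Fin n → K) :
    innerForm A H K (∑ i, e i ⊗ₜ k i) (∑ i, e i ⊗ₜ k i) = ∑ i, inner A (k i) (k i) := by
  simp [map_sum, LinearMap.sum_apply, orthonormal_iff_ite.mp he]

variable (A H K) in
instance : Inner A (PreTensor A H K) := ⟨fun x y => innerForm A H K x y⟩

variable (A H K) in
instance : SMul A (PreTensor A H K) := ⟨fun a => (actLinear K a).lTensor H⟩

variable (A H K) in
instance : Norm (PreTensor A H K) := ⟨fun x => √‖inner A x x‖⟩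

variable [StarOrderedRing A]

variable (A H K) in
instance : CStarModule A (PreTensor A H K) where
  inner_add_right {x y z} := (innerForm A H K x).map_add y z
  inner_self_nonneg {x} := by
    obtain ⟨n, e, k, he, hx⟩ := exists_orthonormal_sum (H := H) (K := K) x
    have h : inner A x x = ∑ i, inner A (k i) (k i) := by
      rw [← innerForm_orthonormal he k, ← hx]; rfl
    rw [h]
    exact Finset.sum_nonneg fun _ _ => CStarModule.inner_self_nonneg
  inner_self {x} := by
    obtain ⟨n, e, k, he, hx⟩ := exists_orthonormal_sum (H := H) (K := K) x
    have h : inner A x x = ∑ i, inner A (k i) (k i) := by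
      rw [← innerForm_orthonormal he k, ← hx]; rfl
    constructor
    · intro h0
      rw [h, Finset.sum_eq_zero_iff_of_nonneg fun _ _ => CStarModule.inner_self_nonneg] at h0
      have hk : ∀ i, k i = 0 := fun i => CStarModule.inner_self.mp (h0 i (Finset.mem_univ i))
      rw [hx]
      simp only [hk, TensorProduct.tmul_zero, Finset.sum_const_zero]
      rfl
    · rintro rfl
      exact (innerForm A H K 0).map_zero
  inner_op_smul_right {a x y} := innerForm_act a x y
  inner_smul_right_complex {z x y} := (innerForm A H K x).map_smul z y
  star_inner x y := innerForm_star x y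
  norm_eq_sqrt_norm_inner_self _ := rfl

variable (A H K) in
instance : NormedAddCommGroup (PreTensor A H K) :=
  NormedAddCommGroup.ofCore (CStarModule.normedSpaceCore A)

variable (A H K) in
instance : NormedSpace ℂ (PreTensor A H K) :=
  NormedSpace.ofCore (CStarModule.normedSpaceCore A)

/-- For an isometry `T` of `H`, the operator `T ⊗ 1` on the algebraic tensor product. -/
def isometryTensorOne (A K : Type*) {H : Type*} [NonUnitalCStarAlgebra A] [PartialOrder A]
    [StarOrderedRing A] [NormedAddCommGroup H] [InnerProductSpace ℂ H]
    [NormedAddCommGroup K] [NormedSpace ℂ K] [SMul A K] [CStarModule A K]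
    (T : H →ₗᵢ[ℂ] H) : PreTensor A H K →ₗᵢ[ℂ] PreTensor A H K where
  toFun := T.toLinearMap.rTensor K
  map_add' := (T.toLinearMap.rTensor K).map_add
  map_smul' := (T.toLinearMap.rTensor K).map_smul
  norm_map' x := by
    have h : ∀ y z : H ⊗[ℂ] K, innerForm A H K (T.toLinearMap.rTensor K y)
        (T.toLinearMap.rTensor K z) = innerForm A H K y z := by
      intro y z
      induction y with
      | zero => simp
      | add y₁ y₂ h₁ h₂ => simp [h₁, h₂]
      | tmul h k =>
        induction z with
        | zero => simp
        | add z₁ z₂ h₁ h₂ => rw [map_add, map_add, map_add, h₁, h₂]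
        | tmul h' k' => simp
    exact congrArg (fun a : A => √‖a‖) (h x x)

end PreTensor

/-- The external tensor product `H ⊗ K` of a Hilbert space `H` (a Hilbert `ℂ`-module) and
a Hilbert `A`-module `K`: the completion of the algebraic tensor product. -/
abbrev Tensor (A H K : Type*) [NonUnitalCStarAlgebra A] [PartialOrder A] [StarOrderedRing A]
    [NormedAddCommGroup H] [InnerProductSpace ℂ H]
    [NormedAddCommGroup K] [NormedSpace ℂ K] [SMul A K] [CStarModule A K] : Type _ :=
  UniformSpace.Completion (PreTensor A H K)

namespace Tensor

variable (A : Type*) {H K : Type*} [NonUnitalCStarAlgebra A] [PartialOrder A] [StarOrderedRing A]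
  [NormedAddCommGroup H] [InnerProductSpace ℂ H]
  [NormedAddCommGroup K] [NormedSpace ℂ K] [SMul A K] [CStarModule A K]

/-- The elementary tensor `h ⊗ k`. -/
def tmul (h : H) (k : K) : Tensor A H K :=
  UniformSpace.Completion.coe' (PreTensor.tmul A h k)

theorem inner_tmul (h h' : H) (k k' : K) :
    inner A (tmul A h k) (tmul A h' k') = (inner ℂ h h') • inner A k k' :=
  completion_inner_coe (PreTensor.tmul A h k) (PreTensor.tmul A h' k')

theorem act_tmul (a : A) (h : H) (k : K) : a • tmul A h k = tmul A h (a • k) := by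
  have := uniformContinuousConstSMul A (PreTensor A H K)
  exact (UniformSpace.Completion.coe_smul a (PreTensor.tmul A h k)).symm

variable (K) in
/-- For an isometry `T` of `H`, the operator `T ⊗ 1` on `H ⊗ K`, i.e. the continuous linear
extension of `h ⊗ k ↦ T h ⊗ k`. -/
def isometryTensorOne (T : H →ₗᵢ[ℂ] H) : Tensor A H K →L[ℂ] Tensor A H K :=
  (PreTensor.isometryTensorOne A K T).toContinuousLinearMap.completion

theorem isometryTensorOne_tmul (T : H →ₗᵢ[ℂ] H) (h : H) (k : K) :
    isometryTensorOne A K T (tmul A h k) = tmul A (T h) k :=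
  ContinuousLinearMap.completion_apply_coe
    (PreTensor.isometryTensorOne A K T).toContinuousLinearMap (PreTensor.tmul A h k)

end Tensor

/-! ### The shift semigroup on `L²(ℝ₊^d)` -/

section Shift

variable (d : ℕ)

/-- Lebesgue measure on the orthant `ℝ₊^d = {x ∈ ℝ^d | 0 ≤ x}`. -/
def orthantMeasure : Measure (Fin d → ℝ) := volume.restrict (Set.Ici 0)

/-- The Hilbert space `L²(ℝ₊^d)`. -/
abbrev L2Orthant : Type := Lp ℂ 2 (orthantMeasure d)

variable {d}

/-- The vector `t ∈ ℝ₊^d` as an element of `ℝ^d`. -/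
def toReal (t : Fin d → ℝ≥0) : Fin d → ℝ := fun i => (t i : ℝ)

/-- The translate of a function `f` on `ℝ₊^d` by `t`: the value at `x` is `f (x - t)` if
`x - t ∈ ℝ₊^d`, and `0` otherwise. -/
def shiftFun (t : Fin d → ℝ≥0) (f : (Fin d → ℝ) → ℂ) : (Fin d → ℝ) → ℂ :=
  Set.indicator {x | 0 ≤ x - toReal t} fun x => f (x - toReal t)

theorem measurableSet_shift (t : Fin d → ℝ≥0) :
    MeasurableSet {x : Fin d → ℝ | 0 ≤ x - toReal t} :=
  measurableSet_Ici.preimage (measurable_id.sub_const (toReal t))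

theorem measurePreserving_shift (t : Fin d → ℝ≥0) :
    MeasurePreserving (fun x : Fin d → ℝ => x - toReal t)
      ((orthantMeasure d).restrict {x | 0 ≤ x - toReal t}) (orthantMeasure d) := by
  have h : (orthantMeasure d).restrict {x | 0 ≤ x - toReal t}
      = volume.restrict ((fun x : Fin d → ℝ => x - toReal t) ⁻¹' Set.Ici 0) := by
    rw [orthantMeasure, Measure.restrict_restrict (measurableSet_shift t)]
    congr 1
    ext x
    simp only [Set.mem_inter_iff, Set.mem_ofPred_eq, Set.mem_Ici, Set.mem_preimage,
      and_iff_left_iff_imp]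
    intro hx i
    have h1 := hx i
    simp only [Pi.zero_apply, Pi.sub_apply, toReal] at h1 ⊢
    have h2 := (t i).coe_nonneg
    linarith
  rw [h]
  exact (measurePreserving_sub_right volume (toReal t)).restrict_preimage measurableSet_Ici

theorem eLpNorm_shiftFun (t : Fin d → ℝ≥0) {f : (Fin d → ℝ) → ℂ}
    (hf : AEStronglyMeasurable f (orthantMeasure d)) :
    eLpNorm (shiftFun t f) 2 (orthantMeasure d) = eLpNorm f 2 (orthantMeasure d) := by
  rw [shiftFun, eLpNorm_indicator_eq_eLpNorm_restrict (measurableSet_shift t)]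
  exact eLpNorm_comp_measurePreserving hf (measurePreserving_shift t)

theorem memLp_shiftFun (t : Fin d → ℝ≥0) {f : (Fin d → ℝ) → ℂ}
    (hf : MemLp f 2 (orthantMeasure d)) : MemLp (shiftFun t f) 2 (orthantMeasure d) :=
  (memLp_indicator_iff_restrict (measurableSet_shift t)).mpr
    (hf.comp_measurePreserving (measurePreserving_shift t))

theorem shiftFun_ae_congr (t : Fin d → ℝ≥0) {f g : (Fin d → ℝ) → ℂ}
    (h : f =ᵐ[orthantMeasure d] g) : shiftFun t f =ᵐ[orthantMeasure d] shiftFun t g := by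
  have h1 := (measurePreserving_shift t).quasiMeasurePreserving.ae_eq_comp h
  exact (indicator_ae_eq_iff_ae_eq_restrict t).mpr h1
where
  indicator_ae_eq_iff_ae_eq_restrict (t : Fin d → ℝ≥0) {f g : (Fin d → ℝ) → ℂ} :
      Set.indicator {x | 0 ≤ x - toReal t} f =ᵐ[orthantMeasure d]
        Set.indicator {x | 0 ≤ x - toReal t} g ↔
      f =ᵐ[(orthantMeasure d).restrict {x | 0 ≤ x - toReal t}] g := by
    rw [Filter.EventuallyEq, Filter.EventuallyEq, ae_restrict_iff' (measurableSet_shift t)]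
    refine eventually_congr (Eventually.of_forall fun x => ?_)
    by_cases hx : x ∈ {x | 0 ≤ x - toReal t}
    · simp only [Set.indicator_of_mem hx, hx, forall_const]
    · simp only [Set.indicator_of_notMem hx, hx, false_imp_iff]

/-- The shift `S_t` on `L²(ℝ₊^d)`: `(S_t f)(x) = f (x - t)` if `x - t ∈ ℝ₊^d`,
and `(S_t f)(x) = 0` otherwise. -/
def shift (t : Fin d → ℝ≥0) : L2Orthant d →ₗᵢ[ℂ] L2Orthant d where
  toFun f := (memLp_shiftFun t (Lp.memLp f)).toLp (shiftFun t f)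
  map_add' f g := by
    rw [← MemLp.toLp_add]
    refine (MemLp.toLp_eq_toLp_iff _ _).mpr ((shiftFun_ae_congr t (Lp.coeFn_add f g)).trans ?_)
    exact Eventually.of_forall fun x => congrFun (Set.indicator_add _ _ _) x
  map_smul' c f := by
    rw [RingHom.id_apply, ← MemLp.toLp_const_smul]
    refine (MemLp.toLp_eq_toLp_iff _ _).mpr ((shiftFun_ae_congr t (Lp.coeFn_smul c f)).trans ?_)
    exact Eventually.of_forall fun x => congrFun (Set.indicator_const_smul _ c _) x
  norm_map' f := by
    change ‖(memLp_shiftFun t (Lp.memLp f)).toLp (shiftFun t f)‖ = _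
    rw [Lp.norm_toLp, eLpNorm_shiftFun t (Lp.aestronglyMeasurable f), Lp.norm_def]

/-- The function `x ↦ √(2^d ∏ᵢ Re zᵢ) * exp (- ∑ᵢ zᵢ xᵢ)`. -/
def expFun (z : Fin d → ℂ) (x : Fin d → ℝ) : ℂ :=
  (√(2 ^ d * ∏ i, (z i).re) : ℝ) * Complex.exp (-∑ i, z i * (x i : ℂ))

theorem memLp_expFun {z : Fin d → ℂ} (hz : ∀ i, 0 < (z i).re) :
    MemLp (expFun z) 2 (orthantMeasure d) := by
  have hcont : Continuous (expFun z) := by unfold expFun; fun_prop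
  rw [memLp_two_iff_integrable_sq_norm hcont.aestronglyMeasurable]
  have h1 : Integrable (fun x : Fin d → ℝ => ∏ i, Real.exp (-(2 * (z i).re) * x i))
      (orthantMeasure d) := by
    have h2 : orthantMeasure d
        = Measure.pi fun _ : Fin d => (volume : Measure ℝ).restrict (Set.Ici 0) := by
      rw [orthantMeasure, ← Set.pi_univ_Ici, volume_pi,
        Measure.restrict_pi_pi (fun _ : Fin d => (volume : Measure ℝ))]
      rfl
    rw [h2]
    refine Integrable.fintype_prod (μ := fun _ : Fin d => volume.restrict (Set.Ici 0))
      (f := fun i (y : ℝ) => Real.exp (-(2 * (z i).re) * y)) fun i => ?_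
    have h3 := integrableOn_exp_mul_Ioi (a := -(2 * (z i).re)) (by linarith [hz i]) 0
    exact (integrableOn_Ici_iff_integrableOn_Ioi (μ := volume)).mpr h3
  have h4 : (fun x => ‖expFun z x‖ ^ 2) = fun x : Fin d → ℝ =>
      (√(2 ^ d * ∏ i, (z i).re)) ^ 2 * ∏ i, Real.exp (-(2 * (z i).re) * x i) := by
    funext x
    rw [expFun, norm_mul, mul_pow, Complex.norm_real, Real.norm_eq_abs, sq_abs, Complex.norm_exp,
      ← Real.exp_nat_mul, ← Real.exp_sum]
    congr 2
    simp only [Complex.neg_re, Complex.re_sum, Complex.re_mul_ofReal, Nat.cast_ofNat,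
      mul_neg, Finset.mul_sum, ← Finset.sum_neg_distrib]
    exact Finset.sum_congr rfl fun i _ => by ring
  rw [h4]
  exact h1.const_mul _

/-- The vector `f_z ∈ L²(ℝ₊^d)` for `z ∈ ℂ^d` with `Re zᵢ > 0` for all `i`. -/
def expVec (z : Fin d → ℂ) (hz : ∀ i, 0 < (z i).re) : L2Orthant d :=
  (memLp_expFun hz).toLp (expFun z)

end Shift

/-! ### Semigroups of isometries of `ℝ₊^d` on a Hilbert module -/

section Semigroup

variable {A E : Type*} [NonUnitalCStarAlgebra A] [PartialOrder A]
  [NormedAddCommGroup E] [NormedSpace ℂ E] [SMul A E] [CStarModule A E] {d : ℕ}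

/-- A strictly continuous semigroup of isometries indexed by `ℝ₊^d`. -/
structure IsIsometricSemigroup (V : (Fin d → ℝ≥0) → Adjointable A E E) : Prop where
  map_zero : V 0 = 1
  map_add : ∀ s t, V (s + t) = V s * V t
  isometric : ∀ t, star (V t) * V t = 1
  strictlyContinuous : Continuous V

/-- `V` is doubly commuting: `V_{s e_i}` commutes with `V_{t e_j}⋆` for all `i ≠ j`. -/
def DoublyCommuting (V : (Fin d → ℝ≥0) → Adjointable A E E) : Prop :=
  ∀ i j : Fin d, i ≠ j → ∀ s t : ℝ≥0,
    V (Pi.single i s) * star (V (Pi.single j t)) = star (V (Pi.single j t)) * V (Pi.single i s)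

/-- `V` is strongly pure: `V_{t e_i} V_{t e_i}⋆ → 0` strictly as `t → ∞`, for every `i`. -/
def StronglyPure (V : (Fin d → ℝ≥0) → Adjointable A E E) : Prop :=
  ∀ i : Fin d,
    Tendsto (fun t : ℝ≥0 => V (Pi.single i t) * star (V (Pi.single i t))) atTop (𝓝 0)

/-- The joint eigenmodule
`K_z = {ξ ∈ E | V_t⋆ ξ = exp (- ∑ᵢ zᵢ tᵢ) ξ for all t ∈ ℝ₊^d}`. -/
def eigenmodule (V : (Fin d → ℝ≥0) → Adjointable A E E) (z : Fin d → ℂ) : Submodule ℂ E where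
  carrier := {ξ | ∀ t, star (V t) ξ = Complex.exp (-∑ i, z i * ((t i : ℝ) : ℂ)) • ξ}
  add_mem' {ξ η} hξ hη t := by rw [Adjointable.map_add, hξ t, hη t, smul_add]
  zero_mem' t := by
    have h := Adjointable.map_complex_smul (star (V t)) 0 (0 : E)
    rw [zero_smul, zero_smul] at h
    rw [h, smul_zero]
  smul_mem' c ξ hξ t := by rw [Adjointable.map_complex_smul, hξ t, smul_comm]

theorem act_mem_eigenmodule (V : (Fin d → ℝ≥0) → Adjointable A E E) (z : Fin d → ℂ) (a : A)
    {ξ : E} (hξ : ξ ∈ eigenmodule V z) : a • ξ ∈ eigenmodule V z := fun t => by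
  rw [Adjointable.map_act, hξ t, act_complex_smul]

instance (V : (Fin d → ℝ≥0) → Adjointable A E E) (z : Fin d → ℂ) : SMul A (eigenmodule V z) :=
  ⟨fun a ξ => ⟨a • (ξ : E), act_mem_eigenmodule V z a ξ.2⟩⟩

/-- `K_z` as a Hilbert module, with the structure inherited from `E`. -/
instance (V : (Fin d → ℝ≥0) → Adjointable A E E) (z : Fin d → ℂ) :
    CStarModule A (eigenmodule V z) where
  inner ξ η := inner A (ξ : E) (η : E)
  inner_add_right := CStarModule.inner_add_right
  inner_self_nonneg := CStarModule.inner_self_nonneg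
  inner_self := CStarModule.inner_self.trans Submodule.coe_eq_zero
  inner_op_smul_right := CStarModule.inner_op_smul_right
  inner_smul_right_complex := CStarModule.inner_smul_right_complex
  star_inner ξ η := CStarModule.star_inner (ξ : E) (η : E)
  norm_eq_sqrt_norm_inner_self ξ := CStarModule.norm_eq_sqrt_norm_inner_self (ξ : E)

end Semigroup

end HilbertMod

end

open MeasureTheory Filter Topology
open scoped NNReal ENNReal TensorProduct InnerProductSpace

noncomputable section

namespace HilbertMod

/-! ### One-parameter semigroups with a contractive left inverse semigroup -/

section OneParameter

variable {X : Type*} [NormedAddCommGroup X] [NormedSpace ℂ X]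

/-! The unitary has to send $V_t\xi$ to $S_tf_z\otimes\xi$ for $t\in\mathbb{R}_+^d$ and $\xi\in
K_z$. It exists as soon as both families have the same $\mathcal{A}$-valued Gram matrix and both are
total (`exists_linearIsometryEquiv_of_gram`). The intertwining relation and $U\xi=f_z\otimes\xi$ can
then be read off on the families.

Equality of the Gram matrices is a computation one coordinate at a time: double commutation
factorises $\langle V_s\xi,V_t\eta\rangle$ (`inner_map_eigenmodule`), and $f_z$ is a product of
one-variable exponentials (`inner_shift_expVec`). Totality in $L^2$ is measure-theoretic: a vector
orthogonal to all $S_tf_z$ gives a function whose integrals over all corners $\{x\ge t\}$ vanish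
(`dense_span_shift_expVec`).

The substantial point is totality of the $V_t\xi$ in $E$. Closed submodules of a Hilbert module need
not be complemented, so the argument uses Banach space functionals instead of orthogonality. Let
$V$, $W$ be one-parameter contraction semigroups with $W_tV_t=1$ and $V_tW_t\to0$ strongly, and let
$\varphi$ kill every $V_tx$ with $x$ an eigenvector of $W$. If $f$ has image $f'$ under the
generator of $W$, then $f-\int_0^\infty e^{-zt}V_t(f'+zf)\,dt$ is an eigenvector
(`isEigenvector_sub_laplace`). Hence $\varphi(V_uf)$ equals an explicit integral, with derivative
$-\varphi(V_uf')$ in $u$. So $\varphi(V_uW_uf)$ has zero right derivative and is constantly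
$\varphi(f)$, while purity sends it to $0$ (`functional_eq_zero`). Such $f$ are dense, so
$\varphi=0$.

For general $d$ this is applied one direction at a time inside the spaces of vectors that are
already eigenvectors in some of the directions. Double commutation keeps these spaces invariant
under the remaining isometries (`partialEigenmodule_le`, `dense_span_eigenmodule`). -/

/-- A strongly continuous one-parameter semigroup `V` of contractions of a Banach space together
with a strongly continuous semigroup `W` of contractions such that `W t` is a left inverse
of `V t`. Only the values at `t ≥ 0` are relevant. -/
structure IsSemigroupPair (V W : ℝ → X →L[ℂ] X) : Prop where
  left_zero : ∀ x, V 0 x = x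
  right_zero : ∀ x, W 0 x = x
  left_add : ∀ s t, 0 ≤ s → 0 ≤ t → ∀ x, V (s + t) x = V s (V t x)
  right_add : ∀ s t, 0 ≤ s → 0 ≤ t → ∀ x, W (s + t) x = W s (W t x)
  right_left : ∀ t, 0 ≤ t → ∀ x, W t (V t x) = x
  left_norm_le : ∀ t x, ‖V t x‖ ≤ ‖x‖
  right_norm_le : ∀ t x, ‖W t x‖ ≤ ‖x‖
  left_continuous : ∀ x, Continuous fun t => V t x
  right_continuous : ∀ x, Continuous fun t => W t x

namespace IsSemigroupPair

variable {V W : ℝ → X →L[ℂ] X} {z : ℂ}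

theorem right_left_of_le (h : IsSemigroupPair V W) {s t : ℝ} (hs : 0 ≤ s) (hst : s ≤ t) (x : X) :
    W s (V t x) = V (t - s) x := by
  have := h.left_add s (t - s) hs (by linarith) x
  rw [add_sub_cancel] at this
  rw [this, h.right_left s hs]

theorem right_left_of_ge (h : IsSemigroupPair V W) {s t : ℝ} (ht : 0 ≤ t) (hts : t ≤ s) (x : X) :
    W s (V t x) = W (s - t) x := by
  have := h.right_add (s - t) t (by linarith) ht (V t x)
  rw [sub_add_cancel] at this
  rw [this, h.right_left t ht]

theorem integrableOn_laplace (h : IsSemigroupPair V W) (hz : 0 < z.re) (x : X) (s : ℝ) :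
    IntegrableOn (fun t : ℝ => Complex.exp (-(z * t)) • V t x) (Set.Ioi s) := by
  have h1 : IntegrableOn (fun t : ℝ => Real.exp (-z.re * t) * ‖x‖) (Set.Ioi s) :=
    (exp_neg_integrableOn_Ioi s hz).mul_const _
  have hc := h.left_continuous x
  refine Integrable.mono' h1 (by fun_prop) (Eventually.of_forall fun t => ?_)
  rw [norm_smul, Complex.norm_exp]
  have : (-(z * t)).re = -z.re * t := by simp
  rw [this]
  gcongr
  exact h.left_norm_le t x

/-- The Laplace transform `∫₀^∞ exp (-z t) V_t x dt`. -/
def laplace (V : ℝ → X →L[ℂ] X) (z : ℂ) (x : X) : X :=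
  ∫ t in Set.Ioi (0 : ℝ), Complex.exp (-(z * t)) • V t x

theorem integral_Ioi_translate (f : ℝ → X) (s : ℝ) :
    ∫ t in Set.Ioi s, f (t - s) = ∫ t in Set.Ioi (0 : ℝ), f t := by
  have h := (measurePreserving_sub_right (volume : Measure ℝ) s).setIntegral_preimage_emb
    (MeasurableEquiv.subRight s).measurableEmbedding f (Set.Ioi 0)
  have h2 : (fun x : ℝ => x - s) ⁻¹' Set.Ioi 0 = Set.Ioi s := by ext; simp
  rwa [h2] at h

theorem integral_Ioi_exp_translate (V : ℝ → X →L[ℂ] X) (z : ℂ) (x : X) (s : ℝ) :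
    ∫ t in Set.Ioi s, Complex.exp (-(z * t)) • V (t - s) x
      = Complex.exp (-(z * s)) • laplace V z x := by
  rw [laplace, ← integral_smul, ← integral_Ioi_translate _ s]
  congr 1
  funext t
  rw [smul_smul, ← Complex.exp_add]
  congr 2
  push_cast
  ring

variable [CompleteSpace X]

/-- Split the integral at $t=s$: below $s$ the product $W_sV_t$ is $W_{s-t}$, above it is $V_{t-s}$.
Infinitesimally this says that `laplace V z` is a right inverse of $z$ plus the generator of $W$. -/
theorem right_laplace (h : IsSemigroupPair V W) (hz : 0 < z.re) (x : X) {s : ℝ} (hs : 0 ≤ s) :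
    W s (laplace V z x) = Complex.exp (-(z * s)) •
      ((∫ u in (0 : ℝ)..s, Complex.exp (z * u) • W u x) + laplace V z x) := by
  have h0 := h.integrableOn_laplace hz x 0
  have h1 : IntegrableOn (fun t : ℝ => Complex.exp (-(z * t)) • W s (V t x)) (Set.Ioi 0) := by
    have := (W s).integrable_comp h0
    simp only [map_smul] at this
    exact this
  have h2 : W s (laplace V z x)
      = ∫ t in Set.Ioi (0 : ℝ), Complex.exp (-(z * t)) • W s (V t x) := by
    rw [laplace, ← (W s).integral_comp_comm h0]
    simp only [map_smul]
  rw [h2, ← sub_add_cancel (∫ t in Set.Ioi (0 : ℝ), Complex.exp (-(z * t)) • W s (V t x))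
    (∫ t in Set.Ioi s, Complex.exp (-(z * t)) • W s (V t x)),
    intervalIntegral.integral_Ioi_sub_Ioi h1 hs, smul_add]
  congr 1
  · have h3 : ∫ t in (0 : ℝ)..s, Complex.exp (-(z * t)) • W s (V t x)
        = ∫ t in (0 : ℝ)..s, Complex.exp (-(z * s)) •
          (fun u : ℝ => Complex.exp (z * u) • W u x) (s - t) := by
      refine intervalIntegral.integral_congr fun t ht => ?_
      rw [Set.uIcc_of_le hs] at ht
      simp only
      rw [h.right_left_of_ge ht.1 ht.2, smul_smul, ← Complex.exp_add]
      congr 2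
      push_cast
      ring
    rw [h3, intervalIntegral.integral_smul, intervalIntegral.integral_comp_sub_left
      (fun u : ℝ => Complex.exp (z * u) • W u x) s, sub_self, sub_zero]
  · rw [← integral_Ioi_exp_translate V z x s]
    refine setIntegral_congr_fun measurableSet_Ioi fun t ht => ?_
    rw [h.right_left_of_le hs (le_of_lt ht)]

/-- `f'` is the image of `f` under the generator of `W`. -/
def IsGenerator (W : ℝ → X →L[ℂ] X) (f f' : X) : Prop :=
  ∀ t : ℝ, 0 ≤ t → HasDerivWithinAt (fun u => W u f) (W t f') (Set.Ici t) t

omit [CompleteSpace X] in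
theorem IsGenerator.apply_right (h : IsSemigroupPair V W) {f f' : X} (hf : IsGenerator W f f')
    {s : ℝ} (hs : 0 ≤ s) : IsGenerator W (W s f) (W s f') := fun t ht => by
  rw [← h.right_add t s ht hs]
  have h1 := hf (t + s) (by linarith)
  have h2 : HasDerivWithinAt (fun u : ℝ => u + s) 1 (Set.Ici t) t :=
    (hasDerivAt_id t).hasDerivWithinAt.add_const s
  have h3 := HasDerivWithinAt.scomp t h1 h2 (fun u hu => by simpa using hu)
  rw [one_smul] at h3
  refine h3.congr (fun u hu => ?_) ?_
  · exact (h.right_add u s (ht.trans hu) hs f).symm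
  · exact (h.right_add t s ht hs f).symm

/-- Since $W_u\int_0^\varepsilon W_vg\,dv=\int_u^{u+\varepsilon}W_vg\,dv$, the fundamental theorem
of calculus applies. These averages supply enough vectors in the domain of the generator. -/
theorem isGenerator_integral (h : IsSemigroupPair V W) (g : X) {ε : ℝ} (hε : 0 ≤ ε) :
    IsGenerator W (∫ u in (0 : ℝ)..ε, W u g) (W ε g - g) := fun t ht => by
  have hc := h.right_continuous g
  have h1 : ∀ u ∈ Set.Ici t, W u (∫ v in (0 : ℝ)..ε, W v g)
      = (∫ v in (0 : ℝ)..(u + ε), W v g) - ∫ v in (0 : ℝ)..u, W v g := fun u hu => by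
    have hu0 : 0 ≤ u := ht.trans hu
    rw [← (W u).intervalIntegral_comp_comm (hc.intervalIntegrable _ _),
      intervalIntegral.integral_interval_sub_left (hc.intervalIntegrable _ _)
        (hc.intervalIntegrable _ _)]
    have h2 : ∫ v in (0 : ℝ)..ε, W u (W v g) = ∫ v in (0 : ℝ)..ε, (fun v => W v g) (v + u) := by
      refine intervalIntegral.integral_congr fun v hv => ?_
      rw [Set.uIcc_of_le hε] at hv
      simp only
      rw [add_comm, h.right_add u v hu0 hv.1]
    rw [h2, intervalIntegral.integral_comp_add_right (fun v => W v g), zero_add, add_comm]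
  have h2 : ∀ b : ℝ, HasDerivAt (fun u => ∫ v in (0 : ℝ)..u, W v g) (W b g) b := fun b =>
    intervalIntegral.integral_hasDerivAt_right (hc.intervalIntegrable _ _)
      hc.aestronglyMeasurable.stronglyMeasurableAtFilter hc.continuousAt
  have h3 : HasDerivAt (fun u => (∫ v in (0 : ℝ)..(u + ε), W v g) - ∫ v in (0 : ℝ)..u, W v g)
      (W (t + ε) g - W t g) t := ((h2 (t + ε)).comp_add_const t ε).sub (h2 t)
  rw [map_sub, ← h.right_add t ε ht hε]
  exact h3.hasDerivWithinAt.congr h1 (h1 t Set.self_mem_Ici)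

/-- The eigenvectors of `W` with character `t ↦ exp (-z t)`. -/
def IsEigenvector (W : ℝ → X →L[ℂ] X) (z : ℂ) (x : X) : Prop :=
  ∀ t : ℝ, 0 ≤ t → W t x = Complex.exp (-(z * t)) • x

/-- Both $f$ and the Laplace transform of $k=f'+zf$ are sent to $k$ by $z$ plus the generator of
$W$, so their difference lies in its kernel. In integrated form, $e^{zs}W_s$ adds the same term
$\int_0^se^{zu}W_uk\,du$ to each of them. -/
theorem isEigenvector_sub_laplace (h : IsSemigroupPair V W) (hz : 0 < z.re) {f f' : X}
    (hf : IsGenerator W f f') : IsEigenvector W z (f - laplace V z (f' + z • f)) :=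
    fun s hs => by
  have hcf := h.right_continuous f
  have hcf' := h.right_continuous f'
  have h1 : ∫ u in (0 : ℝ)..s, Complex.exp (z * u) • W u (f' + z • f)
      = Complex.exp (z * s) • W s f - f := by
    have h2 := intervalIntegral.integral_eq_sub_of_hasDeriv_right_of_le (a := 0) (b := s)
      (f := fun u : ℝ => Complex.exp (z * u) • W u f)
      (f' := fun u : ℝ => Complex.exp (z * u) • W u (f' + z • f)) hs
      (by fun_prop) (fun u hu => ?_) ?_
    · simpa [h.right_zero] using h2
    · have h3 : HasDerivAt (fun u : ℝ => Complex.exp (z * u)) (Complex.exp (z * u) * z) u := by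
        simpa using ((hasDerivAt_id u).ofReal_comp.const_mul z).cexp
      have h4 := h3.hasDerivWithinAt.smul
        ((hf u hu.1.le).mono Set.Ioi_subset_Ici_self)
      refine h4.congr_deriv ?_
      rw [map_add, map_smul, smul_add, smul_smul]
    · have : Continuous fun u : ℝ => Complex.exp (z * u) • W u (f' + z • f) := by
        have := h.right_continuous (f' + z • f)
        fun_prop
      exact this.intervalIntegrable _ _
  rw [map_sub, h.right_laplace hz _ hs, h1, smul_add, smul_sub, smul_smul, ← Complex.exp_add,
    neg_add_cancel, Complex.exp_zero, one_smul, smul_sub]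
  abel

/-! ### Functionals that annihilate the translated eigenvectors -/

section Functional

variable {φ : StrongDual ℂ X}

/-- Nothing makes $u\mapsto V_uf$ itself differentiable. But $\varphi\circ V_u$ kills the
eigenvector $f-Lk$, where $k=f'+zf$ and $L$ is the Laplace transform, so
$\varphi(V_uf)=e^{zu}\int_u^\infty e^{-zr}\varphi(V_rk)\,dr$. The derivative of this is
$z\varphi(V_uf)-\varphi(V_uk)=-\varphi(V_uf')$. -/
theorem hasDerivWithinAt_functional_left (h : IsSemigroupPair V W) (hz : 0 < z.re)
    (hφ : ∀ t : ℝ, 0 ≤ t → ∀ x, IsEigenvector W z x → φ (V t x) = 0) {f f' : X}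
    (hf : IsGenerator W f f') {t : ℝ} (ht : 0 ≤ t) :
    HasDerivWithinAt (fun u => φ (V u f)) (-φ (V t f')) (Set.Ici t) t := by
  set k := f' + z • f with hk
  have hc : Continuous fun r : ℝ => Complex.exp (-(z * r)) * φ (V r k) := by
    have := h.left_continuous k
    fun_prop
  have hint : ∀ s, IntegrableOn (fun r : ℝ => Complex.exp (-(z * r)) * φ (V r k)) (Set.Ioi s) :=
    fun s => by
      have := φ.integrable_comp (h.integrableOn_laplace hz k s)
      simp only [map_smul, smul_eq_mul] at this
      exact this
  have h1 : ∀ u : ℝ, 0 ≤ u → φ (V u f) = Complex.exp (z * u) *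
      ((∫ r in Set.Ioi (0 : ℝ), Complex.exp (-(z * r)) * φ (V r k))
        - ∫ r in (0 : ℝ)..u, Complex.exp (-(z * r)) * φ (V r k)) := fun u hu => by
    have h2 := hφ u hu _ (h.isEigenvector_sub_laplace hz hf)
    rw [map_sub, map_sub, sub_eq_zero] at h2
    rw [h2, ← intervalIntegral.integral_Ioi_sub_Ioi (hint 0) hu, sub_sub_cancel, laplace,
      ← (V u).integral_comp_comm (h.integrableOn_laplace hz k 0),
      ← φ.integral_comp_comm ((V u).integrable_comp (h.integrableOn_laplace hz k 0)),
      ← integral_Ioi_translate _ u, ← integral_const_mul]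
    refine setIntegral_congr_fun measurableSet_Ioi fun r hr => ?_
    simp only [map_smul]
    rw [← h.left_add u (r - u) hu (by linarith [Set.mem_Ioi.mp hr]), add_sub_cancel, smul_eq_mul,
      ← mul_assoc, ← Complex.exp_add]
    congr 2
    push_cast
    ring
  have h2 : HasDerivAt (fun u => ∫ r in (0 : ℝ)..u, Complex.exp (-(z * r)) * φ (V r k))
      (Complex.exp (-(z * t)) * φ (V t k)) t :=
    intervalIntegral.integral_hasDerivAt_right (hc.intervalIntegrable _ _)
      hc.aestronglyMeasurable.stronglyMeasurableAtFilter hc.continuousAt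
  have h3 : HasDerivAt (fun u : ℝ => Complex.exp (z * u)) (Complex.exp (z * t) * z) t := by
    simpa using ((hasDerivAt_id t).ofReal_comp.const_mul z).cexp
  have h4 := (h3.mul (h2.const_sub
    (∫ r in Set.Ioi (0 : ℝ), Complex.exp (-(z * r)) * φ (V r k)))).hasDerivWithinAt (s := Set.Ici t)
  refine (h4.congr (fun u hu => h1 u (ht.trans hu)) (h1 t ht)).congr_deriv ?_
  have h5 : Complex.exp (z * t) * Complex.exp (-(z * t)) = 1 := by
    rw [← Complex.exp_add, add_neg_cancel, Complex.exp_zero]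
  have h6 := h1 t ht
  rw [mul_right_comm, ← h6, mul_neg, ← mul_assoc, h5, one_mul, hk]
  simp only [map_add, map_smul, smul_eq_mul]
  ring

/-- A product rule: the derivative of $V$ contributes $-\varphi(V_sW_sf')$ and that of $W$
contributes $+\varphi(V_sW_sf')$. -/
theorem functional_left_right_eq (h : IsSemigroupPair V W) (hz : 0 < z.re)
    (hφ : ∀ t : ℝ, 0 ≤ t → ∀ x, IsEigenvector W z x → φ (V t x) = 0) {f f' : X}
    (hf : IsGenerator W f f') {t : ℝ} (ht : 0 ≤ t) : φ (V t (W t f)) = φ f := by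
  -- Joint continuity of $(u,y)\mapsto V_uy$, from strong continuity together with contractivity.
  have hjoint : ∀ {l : Filter ℝ} {a : ℝ} {y : ℝ → X} {y₀ : X}, Tendsto id l (𝓝 a) →
      Tendsto y l (𝓝 y₀) → Tendsto (fun u => V u (y u)) l (𝓝 (V a y₀)) := by
    intro l a y y₀ hl hy
    have h1 : Tendsto (fun u => V u (y u - y₀)) l (𝓝 0) := by
      refine squeeze_zero_norm (fun u => h.left_norm_le u _) ?_
      simpa using (hy.sub_const y₀).norm
    have h2 : Tendsto (fun u => V u y₀) l (𝓝 (V a y₀)) :=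
      ((h.left_continuous y₀).tendsto a).comp hl
    simpa using h1.add h2
  have hcont : Continuous fun u => φ (V u (W u f)) :=
    φ.continuous.comp (continuous_iff_continuousAt.mpr fun a =>
      hjoint tendsto_id ((h.right_continuous f).tendsto a))
  have hderiv : ∀ s ∈ Set.Ico 0 t,
      HasDerivWithinAt (fun u => φ (V u (W u f))) 0 (Set.Ici s) s := fun s hs => by
    -- Write $V_uW_uf=V_uW_sf+V_u(W_uf-W_sf)$. In the first term only $V$ varies; the second
    -- vanishes at $u=s$, so its slope is $V_u$ applied to the slope of $W$.
    have h1 := h.hasDerivWithinAt_functional_left hz hφ (hf.apply_right h hs.1) hs.1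
    have h2 : HasDerivWithinAt (fun u => φ (V u (W u f - W s f))) (φ (V s (W s f')))
        (Set.Ici s) s := by
      have h3 := hf s hs.1
      rw [hasDerivWithinAt_iff_tendsto_slope] at h3 ⊢
      have h4 := (φ.continuous.tendsto _).comp
        (hjoint (tendsto_id.mono_left (nhdsWithin_le_nhds (s := Set.Ici s \ {s}))) h3)
      refine h4.congr fun u => ?_
      simp [slope_def_module]
    refine (h1.add h2).congr_of_eventuallyEq ?_ ?_ |>.congr_deriv (neg_add_cancel _)
    · exact Eventually.of_forall fun u => by simp
    · simp
  have := constant_of_has_deriv_right_zero hcont.continuousOn hderiv t ⟨ht, le_rfl⟩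
  simpa [h.left_zero, h.right_zero] using this

theorem functional_eq_zero (h : IsSemigroupPair V W) (hz : 0 < z.re)
    (hpure : ∀ x, Tendsto (fun t => V t (W t x)) atTop (𝓝 0))
    (hφ : ∀ t : ℝ, 0 ≤ t → ∀ x, IsEigenvector W z x → φ (V t x) = 0) (x : X) : φ x = 0 := by
  have hgen : ∀ f f', IsGenerator W f f' → φ f = 0 := fun f f' hf => by
    have h1 : Tendsto (fun t => φ (V t (W t f))) atTop (𝓝 (φ 0)) :=
      (φ.continuous.tendsto 0).comp (hpure f)
    rw [map_zero] at h1
    refine tendsto_nhds_unique (tendsto_const_nhds.congr' ?_) h1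
    filter_upwards [eventually_ge_atTop 0] with t ht
    exact (h.functional_left_right_eq hz hφ hf ht).symm
  have hc := h.right_continuous x
  -- The averages $\int_0^\varepsilon W_ux\,du$ are killed by $\varphi$ for $\varepsilon\ge0$, and
  -- their derivative at $0$ is $x$. A right derivative suffices to conclude $\varphi(x)=0$.
  have h1 : HasDerivAt (fun ε => ∫ u in (0 : ℝ)..ε, W u x) x 0 := by
    have := intervalIntegral.integral_hasDerivAt_right (hc.intervalIntegrable 0 0)
      hc.aestronglyMeasurable.stronglyMeasurableAtFilter hc.continuousAt
    rwa [h.right_zero] at this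
  have h2 := (((φ.restrictScalars ℝ).hasFDerivAt).comp_hasDerivAt (0 : ℝ) h1).hasDerivWithinAt (s := Set.Ici 0)
  have h3 : HasDerivWithinAt (fun _ : ℝ => (0 : ℂ)) 0 (Set.Ici (0 : ℝ)) 0 :=
    hasDerivWithinAt_const _ _ _
  refine UniqueDiffWithinAt.eq_deriv _ (uniqueDiffOn_Ici (0 : ℝ) 0 Set.self_mem_Ici)
    (h2.congr (fun ε hε => ?_) ?_) h3
  · exact (hgen _ _ (h.isGenerator_integral x hε)).symm
  · simp

end Functional

omit [CompleteSpace X] in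
-- Hahn–Banach in the quotient by the closure of $M$: a vector outside the closure has a nonzero
-- class, which some functional detects.
theorem _root_.Submodule.dense_of_forall_strongDual {M : Submodule ℂ X}
    (hM : ∀ φ : StrongDual ℂ X, (∀ x ∈ M, φ x = 0) → φ = 0) : Dense (M : Set X) := by
  rw [Submodule.dense_iff_topologicalClosure_eq_top]
  by_contra hne
  obtain ⟨x, -, hx⟩ := SetLike.exists_of_lt (lt_top_iff_ne_top.mpr hne)
  have hc : IsClosed (M.topologicalClosure : Set X) := M.isClosed_topologicalClosure
  have hx' : (M.topologicalClosure.mkQ x) ≠ 0 := by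
    simpa [Submodule.Quotient.mk_eq_zero] using hx
  obtain ⟨g, -, hg⟩ := exists_dual_vector ℂ (M.topologicalClosure.mkQ x) (norm_ne_zero_iff.mpr hx')
  have h1 := hM (g.comp M.topologicalClosure.mkQL) fun y hy => by
    simp [(Submodule.Quotient.mk_eq_zero _).mpr (M.le_topologicalClosure hy)]
  have h2 : g (M.topologicalClosure.mkQ x) = 0 := DFunLike.congr_fun h1 x
  rw [hg] at h2
  exact norm_ne_zero_iff.mpr hx' ((RCLike.ofReal_eq_zero (K := ℂ)).mp h2)

/-- The translates of the eigenvectors of `W` under `V` are total. -/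
theorem dense_span_left_eigenvector (h : IsSemigroupPair V W) (hz : 0 < z.re)
    (hpure : ∀ x, Tendsto (fun t => V t (W t x)) atTop (𝓝 0)) :
    Dense (Submodule.span ℂ {y : X | ∃ t : ℝ, 0 ≤ t ∧ ∃ x, IsEigenvector W z x ∧ y = V t x} :
      Set X) :=
  Submodule.dense_of_forall_strongDual fun _ hφ => ContinuousLinearMap.ext fun x =>
    h.functional_eq_zero hz hpure
      (fun t ht x hx => hφ _ (Submodule.subset_span ⟨t, ht, x, hx, rfl⟩)) x

end IsSemigroupPair

end OneParameter

/-! ### Isometries of Hilbert modules -/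

namespace Adjointable

variable {A E : Type*} [NonUnitalCStarAlgebra A] [PartialOrder A]
  [NormedAddCommGroup E] [NormedSpace ℂ E] [SMul A E] [CStarModule A E]

theorem mul_apply (S T : Adjointable A E E) (x : E) : (S * T) x = S (T x) := rfl

theorem one_apply (x : E) : (1 : Adjointable A E E) x = x := rfl

theorem star_mul_eq (S T : Adjointable A E E) : star (S * T) = star T * star S := rfl

theorem inner_left_eq_star (T : Adjointable A E E) (x y : E) :
    inner A (T x) y = inner A x (star T y) := T.inner_toFun_left x y

theorem inner_star_left_eq (T : Adjointable A E E) (x y : E) :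
    inner A (star T x) y = inner A x (T y) := (T.inner_toFun_right y x).symm

theorem inner_map_map {T : Adjointable A E E} (hT : star T * T = 1) (x y : E) :
    inner A (T x) (T y) = inner A x y := by
  rw [inner_left_eq_star, ← mul_apply, hT, one_apply]

theorem norm_map {T : Adjointable A E E} (hT : star T * T = 1) (x : E) : ‖T x‖ = ‖x‖ := by
  rw [CStarModule.norm_eq_sqrt_norm_inner_self (A := A) (T x), inner_map_map hT,
    ← CStarModule.norm_eq_sqrt_norm_inner_self]

/-- Cauchy–Schwarz for $\langle T^*x,T^*x\rangle=\langle x,TT^*x\rangle$, with $\|TT^*x\|=\|T^*x\|$.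
-/
theorem norm_star_le [StarOrderedRing A] {T : Adjointable A E E} (hT : star T * T = 1) (x : E) :
    ‖star T x‖ ≤ ‖x‖ := by
  have h : ‖star T x‖ ^ 2 ≤ ‖star T x‖ * ‖x‖ := by
    rw [CStarModule.norm_sq_eq A, inner_star_left_eq]
    refine (CStarModule.norm_inner_le E).trans ?_
    rw [norm_map hT, mul_comm]
  by_contra! hlt
  nlinarith [norm_nonneg x]

/-- A contractive adjointable operator as a bounded operator on an invariant subspace. -/
def restrictCLM (T : Adjointable A E E) (N : Submodule ℂ E) (hN : ∀ x ∈ N, T x ∈ N)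
    (hT : ∀ x, ‖T x‖ ≤ ‖x‖) : N →L[ℂ] N :=
  LinearMap.mkContinuous
    { toFun := fun x => ⟨T x, hN x x.2⟩
      map_add' := fun x y => Subtype.ext (T.map_add x y)
      map_smul' := fun c x => Subtype.ext (T.map_complex_smul c x) } 1
    fun x => by simpa using hT x

@[simp]
theorem coe_restrictCLM (T : Adjointable A E E) (N : Submodule ℂ E) (hN : ∀ x ∈ N, T x ∈ N)
    (hT : ∀ x, ‖T x‖ ≤ ‖x‖) (x : N) : (T.restrictCLM N hN hT x : E) = T x := rfl

theorem continuous_eval {Y : Type*} [TopologicalSpace Y] {T : Y → Adjointable A E E}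
    (hT : Continuous T) (x : E) : Continuous fun y => T y x :=
  (continuous_apply x).comp (continuous_fst.comp (continuous_induced_dom.comp hT))

theorem continuous_star_eval {Y : Type*} [TopologicalSpace Y] {T : Y → Adjointable A E E}
    (hT : Continuous T) (x : E) : Continuous fun y => star (T y) x :=
  (continuous_apply x).comp (continuous_snd.comp (continuous_induced_dom.comp hT))

theorem tendsto_eval {Y : Type*} {l : Filter Y} {T : Y → Adjointable A E E}
    {T₀ : Adjointable A E E} (hT : Tendsto T l (𝓝 T₀)) (x : E) :
    Tendsto (fun y => T y x) l (𝓝 (T₀ x)) := by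
  have h : Continuous fun S : Adjointable A E E => S x := continuous_eval continuous_id x
  exact (h.tendsto T₀).comp hT

end Adjointable

/-! ### Totality of the translates of the joint eigenvectors -/

section Total

variable {A E : Type*} [NonUnitalCStarAlgebra A] [PartialOrder A] [StarOrderedRing A]
  [NormedAddCommGroup E] [NormedSpace ℂ E] [SMul A E] [CStarModule A E] {d : ℕ}
  {V : (Fin d → ℝ≥0) → Adjointable A E E} {z : Fin d → ℂ}

/-- The vectors which are eigenvectors of `V_{t e_i}⋆` with eigenvalue `exp (-z_i t)` for all
`i ∈ J` and `t`. -/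
def partialEigenmodule (V : (Fin d → ℝ≥0) → Adjointable A E E) (z : Fin d → ℂ)
    (J : Finset (Fin d)) : Submodule ℂ E where
  carrier := {ξ | ∀ i ∈ J, ∀ t : ℝ≥0,
    star (V (Pi.single i t)) ξ = Complex.exp (-(z i * (t : ℝ))) • ξ}
  add_mem' {ξ η} hξ hη i hi t := by
    rw [Adjointable.map_add, hξ i hi t, hη i hi t, smul_add]
  zero_mem' i _ t := by
    have h := Adjointable.map_complex_smul (star (V (Pi.single i t))) 0 (0 : E)
    rw [zero_smul, zero_smul] at h
    rw [h, smul_zero]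
  smul_mem' c ξ hξ i hi t := by rw [Adjointable.map_complex_smul, hξ i hi t, smul_comm]

namespace IsIsometricSemigroup

omit [StarOrderedRing A] in
theorem map_add_apply (hV : IsIsometricSemigroup V) (s t : Fin d → ℝ≥0) (x : E) :
    V (s + t) x = V s (V t x) := by rw [hV.map_add, Adjointable.mul_apply]

omit [StarOrderedRing A] in
theorem star_map_add_apply (hV : IsIsometricSemigroup V) (s t : Fin d → ℝ≥0) (x : E) :
    star (V (s + t)) x = star (V s) (star (V t) x) := by
  rw [add_comm, hV.map_add, Adjointable.star_mul_eq, Adjointable.mul_apply]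

omit [StarOrderedRing A] in
theorem star_map_zero_apply (hV : IsIsometricSemigroup V) (x : E) : star (V 0) x = x := by
  rw [hV.map_zero]; rfl

theorem continuous_star (hV : IsIsometricSemigroup V) (t : Fin d → ℝ≥0) :
    Continuous fun x => star (V t) x :=
  (AddMonoidHomClass.continuous_of_bound (AddMonoidHom.mk' (star (V t)).toFun
    (Adjointable.map_add _)) 1 fun x => by
      simpa using Adjointable.norm_star_le (hV.isometric t) x)

omit [StarOrderedRing A] in
theorem mem_eigenmodule_iff (hV : IsIsometricSemigroup V) (ξ : E) :
    ξ ∈ eigenmodule V z ↔ ξ ∈ partialEigenmodule V z Finset.univ := by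
  constructor
  · intro h i _ t
    rw [h (Pi.single i t), Finset.sum_eq_single i]
    · simp
    · intro j _ hj
      simp [Pi.single_eq_of_ne hj]
    · simp
  · intro h t
    suffices hs : ∀ s : Finset (Fin d), star (V (∑ i ∈ s, Pi.single i (t i))) ξ
        = Complex.exp (-∑ i ∈ s, z i * ((t i : ℝ) : ℂ)) • ξ by
      simpa [Finset.univ_sum_single] using hs Finset.univ
    intro s
    induction s using Finset.induction_on with
    | empty => simp [hV.star_map_zero_apply]
    | insert i s hi ih =>
      rw [Finset.sum_insert hi, Finset.sum_insert hi, hV.star_map_add_apply, ih,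
        Adjointable.map_complex_smul, h i (Finset.mem_univ i), smul_smul, ← Complex.exp_add,
        neg_add_rev]

theorem isClosed_partialEigenmodule (hV : IsIsometricSemigroup V) (z : Fin d → ℂ)
    (J : Finset (Fin d)) : IsClosed (partialEigenmodule V z J : Set E) := by
  have h : (partialEigenmodule V z J : Set E) = ⋂ i ∈ J, ⋂ t : ℝ≥0,
      {ξ | star (V (Pi.single i t)) ξ = Complex.exp (-(z i * (t : ℝ))) • ξ} := by
    ext ξ
    simp [partialEigenmodule]
  rw [h]
  exact isClosed_biInter fun i _ => isClosed_iInter fun t =>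
    isClosed_eq (hV.continuous_star _) (continuous_const_smul _)

theorem completeSpace_eigenmodule [CompleteSpace E] (hV : IsIsometricSemigroup V)
    (z : Fin d → ℂ) : CompleteSpace (eigenmodule V z) := by
  have h : (eigenmodule V z : Set E) = partialEigenmodule V z Finset.univ :=
    Set.ext fun ξ => hV.mem_eigenmodule_iff ξ
  exact (h ▸ hV.isClosed_partialEigenmodule z Finset.univ :
    IsClosed (eigenmodule V z : Set E)).completeSpace_coe

omit [StarOrderedRing A] in
-- This is where double commutation enters the totality argument. The analogous invariance under the
-- adjoints needs only that the semigroup is commutative.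
theorem map_single_mem (hcomm : DoublyCommuting V) {J : Finset (Fin d)} {i : Fin d} (hi : i ∉ J)
    (t : ℝ≥0) {ξ : E} (hξ : ξ ∈ partialEigenmodule V z J) :
    V (Pi.single i t) ξ ∈ partialEigenmodule V z J := fun j hj s => by
  have hij : i ≠ j := fun h => hi (h ▸ hj)
  rw [← Adjointable.mul_apply, ← hcomm i j hij, Adjointable.mul_apply, hξ j hj,
    Adjointable.map_complex_smul]

omit [StarOrderedRing A] in
theorem star_map_single_mem (hV : IsIsometricSemigroup V) {J : Finset (Fin d)} {i : Fin d}
    (t : ℝ≥0) {ξ : E} (hξ : ξ ∈ partialEigenmodule V z J) :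
    star (V (Pi.single i t)) ξ ∈ partialEigenmodule V z J := fun j hj s => by
  rw [← hV.star_map_add_apply, add_comm, hV.star_map_add_apply, hξ j hj,
    Adjointable.map_complex_smul]

/-- The restriction of `t ↦ V_{t e_i}` to a partial eigenmodule. -/
def restrictLeft (hV : IsIsometricSemigroup V) (hcomm : DoublyCommuting V) (z : Fin d → ℂ)
    {J : Finset (Fin d)} {i : Fin d} (hi : i ∉ J) (t : ℝ) :
    partialEigenmodule V z J →L[ℂ] partialEigenmodule V z J :=
  (V (Pi.single i t.toNNReal)).restrictCLM _ (fun _ => map_single_mem hcomm hi _)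
    fun x => (Adjointable.norm_map (hV.isometric _) x).le

/-- The restriction of `t ↦ V_{t e_i}⋆` to a partial eigenmodule. -/
def restrictRight (hV : IsIsometricSemigroup V) (z : Fin d → ℂ) (J : Finset (Fin d)) (i : Fin d)
    (t : ℝ) : partialEigenmodule V z J →L[ℂ] partialEigenmodule V z J :=
  (star (V (Pi.single i t.toNNReal))).restrictCLM _ (fun _ => hV.star_map_single_mem _)
    fun x => Adjointable.norm_star_le (hV.isometric _) x

theorem isSemigroupPair_restrict (hV : IsIsometricSemigroup V) (hcomm : DoublyCommuting V)
    (z : Fin d → ℂ) {J : Finset (Fin d)} {i : Fin d} (hi : i ∉ J) :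
    IsSemigroupPair (hV.restrictLeft hcomm z hi) (hV.restrictRight z J i) where
  left_zero x := Subtype.ext <| by simp [restrictLeft, hV.map_zero, Adjointable.one_apply]
  right_zero x := Subtype.ext <| by simp [restrictRight, hV.star_map_zero_apply]
  left_add s t hs ht x := Subtype.ext <| by
    simp [restrictLeft, Real.toNNReal_add hs ht, Pi.single_add, hV.map_add_apply]
  right_add s t hs ht x := Subtype.ext <| by
    simp [restrictRight, Real.toNNReal_add hs ht, Pi.single_add, hV.star_map_add_apply]
  right_left t _ x := Subtype.ext <| by
    simp only [restrictLeft, restrictRight, Adjointable.coe_restrictCLM]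
    rw [← Adjointable.mul_apply, hV.isometric, Adjointable.one_apply]
  left_norm_le t x := (Adjointable.norm_map (hV.isometric _) (x : E)).le
  right_norm_le t x := Adjointable.norm_star_le (hV.isometric _) (x : E)
  left_continuous x := Continuous.subtype_mk (Adjointable.continuous_eval
    (hV.strictlyContinuous.comp ((continuous_single i).comp continuous_real_toNNReal)) (x : E)) _
  right_continuous x := Continuous.subtype_mk (Adjointable.continuous_star_eval
    (hV.strictlyContinuous.comp ((continuous_single i).comp continuous_real_toNNReal)) (x : E)) _

/-- The one-parameter totality theorem in direction $e_i$, applied in the Banach space of partial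
eigenvectors for $J$. The eigenvectors found there are partial eigenvectors for $J\cup\{i\}$. -/
theorem partialEigenmodule_le [CompleteSpace E] (hV : IsIsometricSemigroup V)
    (hcomm : DoublyCommuting V) (hpure : StronglyPure V) {J : Finset (Fin d)} {i : Fin d}
    (hi : i ∉ J) (hz : 0 < (z i).re) {M : Submodule ℂ E} (hM : IsClosed (M : Set E))
    (hVM : ∀ (t : ℝ≥0), ∀ ξ ∈ partialEigenmodule V z (insert i J), V (Pi.single i t) ξ ∈ M) :
    partialEigenmodule V z J ≤ M := by
  have hcomplete : CompleteSpace (partialEigenmodule V z J) :=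
    (hV.isClosed_partialEigenmodule z J).completeSpace_coe
  have h := (hV.isSemigroupPair_restrict hcomm z hi).dense_span_left_eigenvector hz fun x => by
    rw [tendsto_subtype_rng]
    have h0 := Adjointable.tendsto_eval (hpure i) (x : E)
    exact h0.comp Real.tendsto_toNNReal_atTop
  intro ξ hξ
  have h1 : IsClosed ((fun x : partialEigenmodule V z J => (x : E)) ⁻¹' M) :=
    hM.preimage continuous_subtype_val
  have h2 : Submodule.span ℂ {y : partialEigenmodule V z J | ∃ t : ℝ, 0 ≤ t ∧ ∃ x,
      IsSemigroupPair.IsEigenvector (hV.restrictRight z J i) (z i) x ∧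
        y = hV.restrictLeft hcomm z hi t x}
      ≤ M.comap (partialEigenmodule V z J).subtype := Submodule.span_le.mpr (by
    rintro _ ⟨t, ht, x, hx, rfl⟩
    suffices hx' : (x : E) ∈ partialEigenmodule V z (insert i J) from hVM t.toNNReal x hx'
    intro j hj s
    rcases Finset.mem_insert.mp hj with rfl | hj
    · have := congrArg Subtype.val (hx s s.coe_nonneg)
      simpa [restrictRight] using this
    · exact x.2 j hj s)
  exact (closure_minimal h2 h1) (h ⟨ξ, hξ⟩)

/-- The translates of the joint eigenvectors are total. -/
theorem dense_span_eigenmodule [CompleteSpace E] (hV : IsIsometricSemigroup V)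
    (hcomm : DoublyCommuting V) (hpure : StronglyPure V) (hz : ∀ i, 0 < (z i).re) :
    Dense (Submodule.span ℂ
      (Set.range fun p : (Fin d → ℝ≥0) × eigenmodule V z => V p.1 p.2) : Set E) := by
  rw [Submodule.dense_iff_topologicalClosure_eq_top, eq_top_iff]
  set M₀ := Submodule.span ℂ
      (Set.range fun p : (Fin d → ℝ≥0) × eigenmodule V z => V p.1 p.2) with hM₀
  have hmem : ∀ t, ∀ ξ ∈ M₀.topologicalClosure, V t ξ ∈ M₀.topologicalClosure := by
    intro t ξ hξ
    let T : E →ₗ[ℂ] E :=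
      { toFun := V t, map_add' := (V t).map_add, map_smul' := (V t).map_complex_smul }
    have hT : Continuous T := AddMonoidHomClass.continuous_of_bound T 1 fun x => by
      simpa [T] using (Adjointable.norm_map (hV.isometric t) x).le
    have h1 : M₀ ≤ M₀.comap T := Submodule.span_le.mpr (by
      rintro _ ⟨p, rfl⟩
      refine Submodule.subset_span ⟨(t + p.1, p.2), ?_⟩
      exact hV.map_add_apply t p.1 p.2)
    exact map_mem_closure hT hξ h1
  -- Induction on the set $s$ of directions in which no eigenvector condition is imposed:
  -- $s=\emptyset$ is the joint eigenmodule, and for $s$ the full index set the condition is void,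
  -- giving all of $E$.
  have hclaim : ∀ s : Finset (Fin d), partialEigenmodule V z sᶜ ≤ M₀.topologicalClosure := by
    intro s
    induction s using Finset.induction_on with
    | empty =>
      rw [Finset.compl_empty]
      intro ξ hξ
      refine M₀.le_topologicalClosure (Submodule.subset_span
        ⟨(0, ⟨ξ, (hV.mem_eigenmodule_iff ξ).mpr hξ⟩), ?_⟩)
      simp [hV.map_zero, Adjointable.one_apply]
    | insert i s hi ih =>
      refine hV.partialEigenmodule_le hcomm hpure (i := i) (by simp) (hz i)
        M₀.isClosed_topologicalClosure fun t ξ hξ => hmem _ ξ (ih ?_)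
      rwa [Finset.insert_compl_insert hi] at hξ
  intro ξ _
  exact hclaim Finset.univ fun i hi => by simp at hi

end IsIsometricSemigroup

end Total

/-! ### Gram matrices -/

section Gram

variable {A E : Type*} [NonUnitalCStarAlgebra A] [PartialOrder A]
  [NormedAddCommGroup E] [NormedSpace ℂ E] [SMul A E] [CStarModule A E] {d : ℕ}
  {V : (Fin d → ℝ≥0) → Adjointable A E E} {z : Fin d → ℂ}

/-- The inner product of the translates by `s` and `t` of the normalised exponential function
with parameter `w` on the half line. -/
def translateGram (w : ℂ) (s t : ℝ≥0) : ℂ :=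
  if s ≤ t then starRingEnd ℂ (Complex.exp (-(w * (t - s : ℝ))))
  else Complex.exp (-(w * (s - t : ℝ)))

namespace IsIsometricSemigroup

theorem star_single_comm (hV : IsIsometricSemigroup V) (hcomm : DoublyCommuting V)
    {J : Finset (Fin d)} {i : Fin d} (hi : i ∉ J) (u : ℝ≥0) (s : Fin d → ℝ≥0) (ξ : E) :
    star (V (Pi.single i u)) (V (∑ j ∈ J, Pi.single j (s j)) ξ)
      = V (∑ j ∈ J, Pi.single j (s j)) (star (V (Pi.single i u)) ξ) := by
  induction J using Finset.induction_on with
  | empty => simp [hV.map_zero, Adjointable.one_apply]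
  | insert j J hj ih =>
    simp only [Finset.mem_insert, not_or] at hi
    rw [Finset.sum_insert hj, hV.map_add_apply, hV.map_add_apply, ← ih hi.2,
      ← Adjointable.mul_apply, ← hcomm j i (Ne.symm hi.1), Adjointable.mul_apply]

/-- In each coordinate the isometry for the smaller of the two times cancels. The leftover power
becomes an adjoint on the other side, passes through the remaining coordinates by double
commutation, and acts on the eigenvector as a scalar. -/
theorem inner_map_eigenmodule (hV : IsIsometricSemigroup V) (hcomm : DoublyCommuting V)
    (s t : Fin d → ℝ≥0) {ξ η : E} (hξ : ξ ∈ eigenmodule V z) (hη : η ∈ eigenmodule V z) :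
    inner A (V s ξ) (V t η) = (∏ i, translateGram (z i) (s i) (t i)) • inner A ξ η := by
  rw [hV.mem_eigenmodule_iff] at hξ hη
  suffices h : ∀ J : Finset (Fin d), inner A (V (∑ j ∈ J, Pi.single j (s j)) ξ)
      (V (∑ j ∈ J, Pi.single j (t j)) η)
        = (∏ i ∈ J, translateGram (z i) (s i) (t i)) • inner A ξ η by
    simpa [Finset.univ_sum_single] using h Finset.univ
  intro J
  induction J using Finset.induction_on with
  | empty => simp [hV.map_zero, Adjointable.one_apply]
  | insert i J hi ih =>
    rw [Finset.sum_insert hi, Finset.sum_insert hi, Finset.prod_insert hi, mul_smul, ← ih]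
    rcases le_or_gt (s i) (t i) with hst | hst
    · have h1 : (Pi.single i (t i) : Fin d → ℝ≥0)
          = Pi.single i (s i) + Pi.single i (t i - s i) := by
        rw [← Pi.single_add, add_tsub_cancel_of_le hst]
      rw [h1, add_assoc, hV.map_add_apply, hV.map_add_apply (Pi.single i (s i)),
        Adjointable.inner_map_map (hV.isometric _), hV.map_add_apply,
        ← Adjointable.inner_star_left_eq, hV.star_single_comm hcomm hi,
        hξ i (Finset.mem_univ i), Adjointable.map_complex_smul,
        CStarModule.inner_smul_left_complex, translateGram, if_pos hst, NNReal.coe_sub hst]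
      rfl
    · have h1 : (Pi.single i (s i) : Fin d → ℝ≥0)
          = Pi.single i (t i) + Pi.single i (s i - t i) := by
        rw [← Pi.single_add, add_tsub_cancel_of_le hst.le]
      rw [h1, add_assoc, hV.map_add_apply, hV.map_add_apply (Pi.single i (t i)),
        Adjointable.inner_map_map (hV.isometric _), hV.map_add_apply,
        Adjointable.inner_left_eq_star, hV.star_single_comm hcomm hi,
        hη i (Finset.mem_univ i), Adjointable.map_complex_smul,
        CStarModule.inner_smul_right_complex, translateGram, if_neg hst.not_ge,
        NNReal.coe_sub hst.le]

end IsIsometricSemigroup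

end Gram

/-! ### Translates of the exponential function in `L²` of the orthant -/

section ShiftExp

variable {d : ℕ} {z : Fin d → ℂ}

theorem orthantMeasure_eq_pi (d : ℕ) : orthantMeasure d
    = Measure.pi fun _ : Fin d => (volume : Measure ℝ).restrict (Set.Ici 0) := by
  rw [orthantMeasure, ← Set.pi_univ_Ici, volume_pi,
    Measure.restrict_pi_pi (fun _ : Fin d => (volume : Measure ℝ))]
  rfl

/-- The translate by `t` of the normalised exponential function on the half line. -/
def expTranslate (w : ℂ) (t : ℝ≥0) : ℝ → ℂ :=
  Set.indicator (Set.Ici (t : ℝ)) fun y => (√(2 * w.re) : ℝ) * Complex.exp (-(w * (y - t : ℝ)))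

/-- The product form reduces inner products on the orthant to integrals over the half line. -/
theorem shiftFun_expFun (hz : ∀ i, 0 < (z i).re) (t : Fin d → ℝ≥0) (x : Fin d → ℝ) :
    shiftFun t (expFun z) x = ∏ i, expTranslate (z i) (t i) (x i) := by
  have hsqrt : √(2 ^ d * ∏ i, (z i).re) = ∏ i, √(2 * (z i).re) := by
    rw [Real.sqrt_eq_iff_mul_self_eq 
        (mul_nonneg (by positivity) (Finset.prod_nonneg fun i _ => (hz i).le)) (by positivity),
      ← Finset.prod_mul_distrib, Finset.prod_congr rfl fun i _ => Real.mul_self_sqrt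
        (by have := hz i; positivity), Finset.prod_mul_distrib]
    simp
  by_cases hx : ∀ i, (t i : ℝ) ≤ x i
  · rw [shiftFun, Set.indicator_of_mem (by intro i; simpa [toReal] using hx i)]
    rw [Finset.prod_congr rfl fun i _ => show expTranslate (z i) (t i) (x i)
      = (√(2 * (z i).re) : ℝ) * Complex.exp (-(z i * (x i - t i : ℝ))) from
        Set.indicator_of_mem (Set.mem_Ici.mpr (hx i)) _]
    rw [expFun, Finset.prod_mul_distrib, ← Complex.exp_sum, hsqrt, Finset.sum_neg_distrib]
    simp [toReal]
  · rw [shiftFun, Set.indicator_of_notMem (fun h => hx fun i => by simpa [toReal] using h i)]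
    push Not at hx
    obtain ⟨i, hi⟩ := hx
    refine (Finset.prod_eq_zero (Finset.mem_univ i) ?_).symm
    exact Set.indicator_of_notMem (by simpa using hi) _

/-- The integrand lives on $[t,\infty)$, where it is the Gram coefficient times the probability
density $2\operatorname{Re}w\;e^{-2\operatorname{Re}w\,(y-t)}$. -/
theorem integral_expTranslate_of_le {w : ℂ} (hw : 0 < w.re) {s t : ℝ≥0} (hst : s ≤ t) :
    ∫ y in Set.Ici (0 : ℝ), starRingEnd ℂ (expTranslate w s y) * expTranslate w t y
      = translateGram w s t := by
  have hst' : (s : ℝ) ≤ t := hst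
  have h1 : (fun y : ℝ => starRingEnd ℂ (expTranslate w s y) * expTranslate w t y)
      = Set.indicator (Set.Ici (t : ℝ)) fun y => translateGram w s t *
        (((2 * w.re) * Real.exp (2 * w.re * t) * Real.exp (-(2 * w.re) * y) : ℝ) : ℂ) := by
    funext y
    by_cases hy : (t : ℝ) ≤ y
    · have hq : (((√(2 * w.re) : ℝ) : ℂ)) * ((√(2 * w.re) : ℝ) : ℂ) = ((2 * w.re : ℝ) : ℂ) := by
        rw [← Complex.ofReal_mul, Real.mul_self_sqrt (by positivity)]
      -- With $\bar w$ eliminated, both exponents are polynomials in $w$ and $\operatorname{Re}w$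
      -- and can be compared by `ring`.
      have hc : starRingEnd ℂ w = ((2 * w.re : ℝ) : ℂ) - w := by
        rw [eq_sub_iff_add_eq, add_comm, Complex.add_conj]
      rw [Set.indicator_of_mem (Set.mem_Ici.mpr hy), expTranslate, expTranslate,
        Set.indicator_of_mem (Set.mem_Ici.mpr hy),
        Set.indicator_of_mem (Set.mem_Ici.mpr (hst'.trans hy)), translateGram, if_pos hst,
        map_mul, Complex.conj_ofReal, mul_mul_mul_comm, hq, ← Complex.exp_conj, ← Complex.exp_conj,
        mul_assoc (2 * w.re), Complex.ofReal_mul (2 * w.re),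
        mul_left_comm (Complex.exp _) ((2 * w.re : ℝ) : ℂ), ← Real.exp_add,
        Complex.ofReal_exp, ← Complex.exp_add, ← Complex.exp_add]
      congr 2
      simp only [map_neg, map_mul, Complex.conj_ofReal, hc]
      push_cast
      ring
    · rw [Set.indicator_of_notMem (by simpa using hy), expTranslate, expTranslate,
        Set.indicator_of_notMem (s := Set.Ici (t : ℝ)) (by simpa using hy), mul_zero]
  have h2 : Set.Ici (t : ℝ) ∩ Set.Ici 0 = Set.Ici (t : ℝ) :=
    Set.inter_eq_left.mpr (Set.Ici_subset_Ici.mpr t.coe_nonneg)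
  rw [h1, integral_indicator measurableSet_Ici, Measure.restrict_restrict measurableSet_Ici, h2,
    integral_const_mul, integral_complex_ofReal, integral_const_mul, integral_Ici_eq_integral_Ioi,
    integral_exp_mul_Ioi (by linarith)]
  have h3 : (2 * w.re) * Real.exp (2 * w.re * t) * (-Real.exp (-(2 * w.re) * t) / (-(2 * w.re)))
      = 1 := by
    rw [neg_div_neg_eq, neg_mul, Real.exp_neg]
    field_simp
  rw [h3, Complex.ofReal_one, mul_one]

theorem conj_translateGram (w : ℂ) (s t : ℝ≥0) :
    starRingEnd ℂ (translateGram w s t) = translateGram w t s := by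
  rcases lt_trichotomy s t with h | rfl | h
  · rw [translateGram, translateGram, if_pos h.le, if_neg h.not_ge, Complex.conj_conj]
  · simp [translateGram]
  · rw [translateGram, translateGram, if_pos h.le, if_neg h.not_ge]

theorem integral_expTranslate {w : ℂ} (hw : 0 < w.re) (s t : ℝ≥0) :
    ∫ y in Set.Ici (0 : ℝ), starRingEnd ℂ (expTranslate w s y) * expTranslate w t y
      = translateGram w s t := by
  rcases le_total s t with hst | hst
  · exact integral_expTranslate_of_le hw hst
  · rw [← conj_translateGram, ← integral_expTranslate_of_le hw hst, ← integral_conj]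
    simp only [map_mul, Complex.conj_conj, mul_comm]

theorem coeFn_shift_expVec (hz : ∀ i, 0 < (z i).re) (t : Fin d → ℝ≥0) :
    shift t (expVec z hz) =ᵐ[orthantMeasure d] shiftFun t (expFun z) :=
  (MemLp.coeFn_toLp (memLp_shiftFun t (Lp.memLp (expVec z hz)))).trans (shiftFun_ae_congr t (MemLp.coeFn_toLp _))

theorem inner_shift_expVec (hz : ∀ i, 0 < (z i).re) (s t : Fin d → ℝ≥0) :
    inner ℂ (shift s (expVec z hz)) (shift t (expVec z hz))
      = ∏ i, translateGram (z i) (s i) (t i) := by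
  have h1 : inner ℂ (shift s (expVec z hz)) (shift t (expVec z hz))
      = ∫ x, ∏ i, (starRingEnd ℂ (expTranslate (z i) (s i) (x i)) *
        expTranslate (z i) (t i) (x i)) ∂(orthantMeasure d) := by
    rw [L2.inner_def]
    refine integral_congr_ae ?_
    filter_upwards [coeFn_shift_expVec hz s, coeFn_shift_expVec hz t] with x hs ht
    rw [hs, ht, shiftFun_expFun hz, shiftFun_expFun hz, RCLike.inner_apply, map_prod, mul_comm,
      Finset.prod_mul_distrib]
  rw [h1, orthantMeasure_eq_pi, integral_fintype_prod_eq_prod (fun i y =>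
    starRingEnd ℂ (expTranslate (z i) (s i) y) * expTranslate (z i) (t i) y)]
  exact Finset.prod_congr rfl fun i _ => integral_expTranslate (hz i) _ _

/-! ### Totality of the translated exponentials in $L^2$ -/

theorem generateFrom_Ici_pi (d : ℕ) : (MeasurableSpace.pi : MeasurableSpace (Fin d → ℝ))
    = MeasurableSpace.generateFrom (Set.range Set.Ici) := by
  have h1 := generateFrom_pi_eq (ι := Fin d) (α := fun _ => ℝ)
    (C := fun _ => Set.range Set.Ici) fun _ => ⟨fun n : ℕ => Set.Ici (-(n : ℝ)),
      fun n => Set.mem_range_self _, Set.iUnion_eq_univ_iff.mpr fun x => by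
        obtain ⟨n, hn⟩ := exists_nat_ge (-x)
        exact ⟨n, Set.mem_Ici.mpr (by linarith)⟩⟩
  have h2 : (fun _ : Fin d => MeasurableSpace.generateFrom (Set.range (Set.Ici : ℝ → Set ℝ)))
      = fun _ => (inferInstance : MeasurableSpace ℝ) := by
    funext _
    rw [← borel_eq_generateFrom_Ici]
    exact (BorelSpace.measurable_eq (α := ℝ)).symm
  rw [h2] at h1
  rw [h1]
  congr 1
  ext S
  constructor
  · rintro ⟨f, hf, rfl⟩
    choose a ha using fun i => hf i (Set.mem_univ i)
    exact ⟨a, by rw [← Set.pi_univ_Ici]; simp only [ha]⟩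
  · rintro ⟨a, rfl⟩
    exact ⟨fun i => Set.Ici (a i), fun i _ => ⟨a i, rfl⟩, Set.pi_univ_Ici a⟩

/-- A $\pi$-$\lambda$ argument: corners are stable under intersection and generate the Borel sets.
-/
theorem ae_eq_zero_of_forall_integral_Ici {f : (Fin d → ℝ) → ℂ}
    (hf : Integrable f (orthantMeasure d))
    (h : ∀ t : Fin d → ℝ≥0, ∫ x in Set.Ici (toReal t), f x ∂(orthantMeasure d) = 0) :
    f =ᵐ[orthantMeasure d] 0 := by
  -- Corners with negative entries are covered too: the measure lives on the orthant, so $a$ may be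
  -- replaced by its positive part.
  have hIci : ∀ a : Fin d → ℝ, ∫ x in Set.Ici a, f x ∂(orthantMeasure d) = 0 := fun a => by
    rw [← h fun i => (a i).toNNReal, orthantMeasure, Measure.restrict_restrict measurableSet_Ici,
      Measure.restrict_restrict measurableSet_Ici]
    congr 2
    ext x
    simp only [Set.mem_inter_iff, Set.mem_Ici, Pi.le_def, toReal, Real.coe_toNNReal', Pi.zero_apply,
      max_le_iff, ← forall_and]
    exact forall_congr' fun i => by tauto
  have huniv : ∫ x, f x ∂(orthantMeasure d) = 0 := by
    rw [← hIci 0, orthantMeasure, Measure.restrict_restrict measurableSet_Ici, Set.inter_self]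
  refine hf.ae_eq_zero_of_forall_setIntegral_eq_zero fun S hS _ => ?_
  refine MeasurableSpace.induction_on_inter
    (C := fun S _ => ∫ x in S, f x ∂(orthantMeasure d) = 0) (generateFrom_Ici_pi d)
    ?_ ?_ ?_ ?_ ?_ S hS
  · rintro _ ⟨a, rfl⟩ _ ⟨b, rfl⟩ _
    exact ⟨a ⊔ b, Set.Ici_inter_Ici.symm⟩
  · simp
  · rintro _ ⟨a, rfl⟩
    exact hIci a
  · intro S hS h0
    have := integral_add_compl hS hf
    rwa [h0, zero_add, huniv] at this
  · intro S hdisj hS h0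
    rw [integral_iUnion hS hdisj hf.integrableOn]
    simp [h0]

/-- On $\{x\ge t\}$ the translate $S_tf_z$ is a nonzero multiple of $f_z$. Orthogonality of $g$ to
all translates thus says that $\overline{f_z}\,g$ integrates to $0$ over every corner, and $f_z$
vanishes nowhere. -/
theorem dense_span_shift_expVec (hz : ∀ i, 0 < (z i).re) :
    Dense (Submodule.span ℂ (Set.range fun t : Fin d → ℝ≥0 => shift t (expVec z hz)) :
      Set (L2Orthant d)) := by
  rw [Submodule.dense_iff_topologicalClosure_eq_top, Submodule.topologicalClosure_eq_top_iff,
    Submodule.eq_bot_iff]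
  intro g hg
  rw [Submodule.mem_orthogonal] at hg
  have h0 : ∀ t, inner ℂ (shift t (expVec z hz)) g = 0 := fun t =>
    hg _ (Submodule.subset_span ⟨t, rfl⟩)
  have hint : Integrable (fun x => inner ℂ (expVec z hz x) (g x)) (orthantMeasure d) :=
    L2.integrable_inner _ _
  have hexp : expVec z hz =ᵐ[orthantMeasure d] expFun z := MemLp.coeFn_toLp _
  have h1 : (fun x => inner ℂ (expVec z hz x) (g x)) =ᵐ[orthantMeasure d] 0 := by
    refine ae_eq_zero_of_forall_integral_Ici hint fun t => ?_
    set c := starRingEnd ℂ (Complex.exp (-∑ i, z i * (toReal t i : ℂ))) with hc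
    have h2 : ∫ x in Set.Ici (toReal t), inner ℂ (expVec z hz x) (g x) ∂(orthantMeasure d)
        = c * inner ℂ (shift t (expVec z hz)) g := by
      rw [L2.inner_def, ← integral_const_mul, ← integral_indicator measurableSet_Ici]
      refine integral_congr_ae ?_
      filter_upwards [coeFn_shift_expVec hz t, hexp] with x hx hx'
      by_cases hxt : toReal t ≤ x
      · rw [Set.indicator_of_mem (Set.mem_Ici.mpr hxt), hx, hx', shiftFun,
          Set.indicator_of_mem (show x ∈ {x | 0 ≤ x - toReal t} from sub_nonneg.mpr hxt),
          RCLike.inner_apply, RCLike.inner_apply, mul_left_comm, hc, ← map_mul, expFun, expFun,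
          mul_left_comm, ← Complex.exp_add, ← neg_add, ← Finset.sum_add_distrib]
        congr 6
        funext i
        simp only [Pi.sub_apply]
        push_cast
        ring
      · rw [Set.indicator_of_notMem (by simpa using hxt), hx, shiftFun,
          Set.indicator_of_notMem (fun h => hxt (sub_nonneg.mp h))]
        simp
    rw [h2, h0, mul_zero]
  refine (Lp.eq_zero_iff_ae_eq_zero).mpr ?_
  filter_upwards [h1, hexp] with x hx hx'
  rw [hx', RCLike.inner_apply] at hx
  refine (mul_eq_zero.mp hx).resolve_right ?_
  rw [map_eq_zero, expFun]
  have : 0 < √(2 ^ d * ∏ i, (z i).re) := Real.sqrt_pos.mpr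
    (mul_pos (by positivity) (Finset.prod_pos fun i _ => hz i))
  exact mul_ne_zero (Complex.ofReal_ne_zero.mpr this.ne') (Complex.exp_ne_zero _)

end ShiftExp

/-! ### Unitaries from total families with equal Gram matrices -/

section Unitary

variable {A X Y : Type*} [NonUnitalCStarAlgebra A] [PartialOrder A] [StarOrderedRing A]
  [NormedAddCommGroup X] [NormedSpace ℂ X] [SMul A X] [CStarModule A X]
  [NormedAddCommGroup Y] [NormedSpace ℂ Y] [SMul A Y] [CStarModule A Y]

/-- A surjective linear isometry which preserves the `A`-valued inner products as an adjointable
operator. -/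
def Adjointable.ofLinearIsometryEquiv (e : X ≃ₗᵢ[ℂ] Y)
    (he : ∀ u v, inner A (e u) (e v) = inner A u v) : Adjointable A X Y where
  toFun := e
  adjFun := e.symm
  inner_toFun_left x y := by rw [← he x (e.symm y), e.apply_symm_apply]

omit [StarOrderedRing A] in
theorem Adjointable.isUnitary_ofLinearIsometryEquiv (e : X ≃ₗᵢ[ℂ] Y)
    (he : ∀ u v, inner A (e u) (e v) = inner A u v) :
    (Adjointable.ofLinearIsometryEquiv e he).IsUnitary :=
  ⟨Adjointable.ext fun x => e.symm_apply_apply x, Adjointable.ext fun y => e.apply_symm_apply y⟩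

omit [StarOrderedRing A] in
theorem Adjointable.IsUnitary.adjoint {U : Adjointable A X Y} (hU : U.IsUnitary) :
    U.adjoint.IsUnitary := ⟨hU.2, hU.1⟩

omit [StarOrderedRing A] in
theorem Adjointable.IsUnitary.adjoint_apply_apply {U : Adjointable A X Y} (hU : U.IsUnitary)
    (x : X) : U.adjoint (U x) = x := congrArg (fun T : Adjointable A X X => T x) hU.1

/-- Equal Gram matrices give $\|\sum a_ix_i\|=\|\sum a_iy_i\|$ for finitely supported scalar
coefficients, so $\sum a_ix_i\mapsto\sum a_iy_i$ is well defined and isometric between dense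
subspaces. Preservation of the $\mathcal{A}$-valued inner product passes to the limit. -/
theorem exists_linearIsometryEquiv_of_gram [CompleteSpace X] [CompleteSpace Y] {ι : Type*}
    {x : ι → X} {y : ι → Y} (hx : Dense (Submodule.span ℂ (Set.range x) : Set X))
    (hy : Dense (Submodule.span ℂ (Set.range y) : Set Y))
    (hxy : ∀ i j, inner A (x i) (x j) = inner A (y i) (y j)) :
    ∃ e : X ≃ₗᵢ[ℂ] Y, (∀ u v, inner A (e u) (e v) = inner A u v) ∧ ∀ i, e (x i) = y i := by
  let S := Finsupp.linearCombination ℂ x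
  let T := Finsupp.linearCombination ℂ y
  have hS : DenseRange S := by
    have h : (Set.range S) = Submodule.span ℂ (Set.range x) := by
      rw [← Finsupp.range_linearCombination]; rfl
    rw [DenseRange, h]
    exact hx
  have hT : DenseRange T := by
    have h : (Set.range T) = Submodule.span ℂ (Set.range y) := by
      rw [← Finsupp.range_linearCombination]; rfl
    rw [DenseRange, h]
    exact hy
  have hinner : ∀ a b, inner A (T a) (T b) = inner A (S a) (S b) := fun a b => by
    simp only [S, T, Finsupp.linearCombination_apply, Finsupp.sum, CStarModule.inner_sum_left,
      CStarModule.inner_sum_right, CStarModule.inner_smul_left_complex,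
      CStarModule.inner_smul_right_complex, hxy]
  have hnorm : ∀ a, ‖T (LinearEquiv.refl ℂ (ι →₀ ℂ) a)‖ = ‖S a‖ := fun a => by
    rw [LinearEquiv.refl_apply, CStarModule.norm_eq_sqrt_norm_inner_self (A := A) (T a), hinner,
      ← CStarModule.norm_eq_sqrt_norm_inner_self]
  let e := (LinearEquiv.refl ℂ (ι →₀ ℂ)).extendOfIsometry S T hS hT hnorm
  have he : ∀ a, e (S a) = T a := fun a =>
    (LinearEquiv.refl ℂ (ι →₀ ℂ)).extendOfIsometry_eq S T hS hT hnorm a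
  refine ⟨e, fun u v => ?_, fun i => ?_⟩
  · refine hS.induction_on₂ (p := fun u v => inner A (e u) (e v) = inner A u v)
      (isClosed_eq ?_ ?_) (fun a b => ?_) u v
    · exact (CStarModule.continuous_inner (A := A) (E := Y)).comp
        ((e.continuous.comp continuous_fst).prodMk (e.continuous.comp continuous_snd))
    · exact CStarModule.continuous_inner
    · rw [he, he, hinner]
  · simpa [S, T] using he (Finsupp.single i 1)

end Unitary

/-! ### The shifts form a semigroup -/

section ShiftAdd

variable {d : ℕ}

theorem shiftFun_shiftFun (s t : Fin d → ℝ≥0) (f : (Fin d → ℝ) → ℂ) :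
    shiftFun s (shiftFun t f) = shiftFun (s + t) f := by
  funext x
  have hst : x - toReal s - toReal t = x - toReal (s + t) := by
    funext i
    simp [toReal, sub_sub]
  by_cases hx : 0 ≤ x - toReal (s + t)
  · have hs : 0 ≤ x - toReal s := fun i => by
      have h1 := hx i
      have h2 := (t i).coe_nonneg
      simp only [toReal, Pi.zero_apply, Pi.sub_apply, Pi.add_apply, NNReal.coe_add] at h1 ⊢
      linarith
    rw [shiftFun, shiftFun, shiftFun, Set.indicator_of_mem (by exact hs),
      Set.indicator_of_mem (show x - toReal s ∈ {x | 0 ≤ x - toReal t} from hst.symm.le.trans' hx), Set.indicator_of_mem (by exact hx), hst]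
  · rw [shiftFun, shiftFun, shiftFun, Set.indicator_of_notMem (s := {x | 0 ≤ x - toReal (s + t)}) hx]
    refine Set.indicator_apply_eq_zero.mpr fun _ => Set.indicator_of_notMem ?_ _
    rw [Set.mem_ofPred_eq, hst]
    exact hx

theorem shift_shift (s t : Fin d → ℝ≥0) (f : L2Orthant d) :
    shift s (shift t f) = shift (s + t) f := by
  refine (MemLp.toLp_eq_toLp_iff (memLp_shiftFun s (Lp.memLp (shift t f)))
    (memLp_shiftFun (s + t) (Lp.memLp f))).mpr ?_
  rw [← shiftFun_shiftFun]
  exact shiftFun_ae_congr s (MemLp.coeFn_toLp (memLp_shiftFun t (Lp.memLp f)))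

/-- An injective idempotent is the identity. -/
theorem shift_zero (f : L2Orthant d) : shift 0 f = f :=
  (shift 0).injective (by rw [shift_shift, add_zero])

end ShiftAdd

/-! ### Elementary tensors -/

section Tensor

variable {A H K : Type*} [NonUnitalCStarAlgebra A] [PartialOrder A] [StarOrderedRing A]
  [NormedAddCommGroup H] [InnerProductSpace ℂ H]
  [NormedAddCommGroup K] [NormedSpace ℂ K] [SMul A K] [CStarModule A K]

/-- The elementary tensor with a fixed second factor, as a bounded operator. -/
def Tensor.tmulCLM (A : Type*) {H K : Type*} [NonUnitalCStarAlgebra A] [PartialOrder A]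
    [StarOrderedRing A] [NormedAddCommGroup H] [InnerProductSpace ℂ H]
    [NormedAddCommGroup K] [NormedSpace ℂ K] [SMul A K] [CStarModule A K] (k : K) :
    H →L[ℂ] Tensor A H K :=
  LinearMap.mkContinuous
    { toFun := fun h => Tensor.tmul A h k
      map_add' := fun h h' => by
        rw [Tensor.tmul, Tensor.tmul, Tensor.tmul, ← UniformSpace.Completion.coe_add]
        exact congrArg _ (TensorProduct.add_tmul h h' k)
      map_smul' := fun c h => by
        rw [RingHom.id_apply, Tensor.tmul, Tensor.tmul, ← UniformSpace.Completion.coe_smul]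
        exact congrArg _ (TensorProduct.smul_tmul' c h k) } ‖k‖
    fun h => by
      have h1 : ‖Tensor.tmul A h k‖ ^ 2 = (‖k‖ * ‖h‖) ^ 2 := by
        rw [CStarModule.norm_sq_eq A, Tensor.inner_tmul, norm_smul, ← CStarModule.norm_sq_eq A,
          inner_self_eq_norm_sq_to_K, norm_pow, RCLike.norm_ofReal, abs_norm]
        ring
      exact ((sq_eq_sq₀ (norm_nonneg _) (by positivity)).mp h1).le

/-- Continuity of $g\mapsto g\otimes k$ for fixed $k$ brings every elementary tensor into the closed
span. -/
theorem Tensor.dense_span_tmul {ι : Type*} {h : ι → H}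
    (hh : Dense (Submodule.span ℂ (Set.range h) : Set H)) :
    Dense (Submodule.span ℂ (Set.range fun p : ι × K => Tensor.tmul A (h p.1) p.2) :
      Set (Tensor A H K)) := by
  rw [Submodule.dense_iff_topologicalClosure_eq_top, eq_top_iff]
  set M := Submodule.span ℂ (Set.range fun p : ι × K => Tensor.tmul A (h p.1) p.2) with hM
  have h1 : ∀ (g : H) (k : K), Tensor.tmul A g k ∈ M.topologicalClosure := fun g k => by
    have h2 : Submodule.span ℂ (Set.range h) ≤ M.comap (Tensor.tmulCLM A k).toLinearMap :=
      Submodule.span_le.mpr (by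
        rintro _ ⟨i, rfl⟩
        exact Submodule.subset_span ⟨(i, k), rfl⟩)
    exact map_mem_closure (f := Tensor.tmulCLM A k) (Tensor.tmulCLM A k).continuous (hh g) h2
  have h2 : ∀ x : PreTensor A H K,
      (x : UniformSpace.Completion (PreTensor A H K)) ∈ M.topologicalClosure := fun x => by
    have h3 : ∀ x : H ⊗[ℂ] K, UniformSpace.Completion.coe' (α := PreTensor A H K) x
        ∈ M.topologicalClosure := fun x => by
      induction x with
      | zero =>
        have := UniformSpace.Completion.coe_zero (α := PreTensor A H K)
        exact this ▸ M.topologicalClosure.zero_mem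
      | tmul g k => exact h1 g k
      | add x y hx hy =>
        have := UniformSpace.Completion.coe_add (α := PreTensor A H K) x y
        exact this ▸ M.topologicalClosure.add_mem hx hy
    exact h3 x
  intro x _
  exact UniformSpace.Completion.induction_on x M.isClosed_topologicalClosure h2

end Tensor

/-! ### The unitary equivalence with the shift semigroup -/

section Main

variable {A E : Type*} [NonUnitalCStarAlgebra A] [PartialOrder A] [StarOrderedRing A]
  [NormedAddCommGroup E] [NormedSpace ℂ E] [CompleteSpace E] [SMul A E] [CStarModule A E] {d : ℕ}
  {V : (Fin d → ℝ≥0) → Adjointable A E E} {z : Fin d → ℂ}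

theorem IsIsometricSemigroup.exists_unitary_shift (hV : IsIsometricSemigroup V)
    (hcomm : DoublyCommuting V) (hpure : StronglyPure V) (hz : ∀ i, 0 < (z i).re) :
    ∃ U : Adjointable A E (Tensor A (L2Orthant d) (eigenmodule V z)),
      U.IsUnitary ∧
      (∀ (t : Fin d → ℝ≥0) (ξ : E),
        U (V t ξ) = Tensor.isometryTensorOne A (eigenmodule V z) (shift t) (U ξ)) ∧
      ∀ ξ : eigenmodule V z, U ξ = Tensor.tmul A (expVec z hz) ξ := by
  obtain ⟨e, he, heV⟩ := exists_linearIsometryEquiv_of_gram (A := A)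
    (hV.dense_span_eigenmodule hcomm hpure hz)
    (Tensor.dense_span_tmul (A := A) (K := eigenmodule V z) (dense_span_shift_expVec hz))
    -- Both families are indexed by pairs $(t,\xi)$ with $\xi\in K_z$, and both Gram entries are the
    -- same product of `translateGram` factors times $\langle\xi,\eta\rangle$.
    fun p q => by
      rw [hV.inner_map_eigenmodule hcomm p.1 q.1 p.2.2 q.2.2, Tensor.inner_tmul,
        inner_shift_expVec]
      rfl
  have hV0 : ∀ ξ, V 0 ξ = ξ := fun ξ => by rw [hV.map_zero, Adjointable.one_apply]
  refine ⟨Adjointable.ofLinearIsometryEquiv e he,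
    Adjointable.isUnitary_ofLinearIsometryEquiv e he, fun t ξ => ?_, fun ξ => ?_⟩
  · let T : E →L[ℂ] E := LinearMap.mkContinuous
      { toFun := V t, map_add' := (V t).map_add, map_smul' := (V t).map_complex_smul } 1
      fun x => by simpa using (Adjointable.norm_map (hV.isometric t) x).le
    have h1 := ContinuousLinearMap.ext_on
      (f := (e.toContinuousLinearEquiv.toContinuousLinearMap).comp T)
      (g := (Tensor.isometryTensorOne A (eigenmodule V z) (shift t)).comp
        e.toContinuousLinearEquiv.toContinuousLinearMap)
      (hV.dense_span_eigenmodule hcomm hpure hz) (by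
        rintro _ ⟨p, rfl⟩
        have h2 : T (V p.1 p.2) = V (t + p.1) p.2 := (hV.map_add_apply t p.1 p.2).symm
        have h3 := heV (t + p.1, p.2)
        have h4 := heV p
        simp only at h3 h4
        change e (T (V p.1 p.2)) = Tensor.isometryTensorOne A (eigenmodule V z) (shift t)
          (e (V p.1 p.2))
        rw [h2, h3, h4, Tensor.isometryTensorOne_tmul, shift_shift])
    exact DFunLike.congr_fun h1 ξ
  · have h1 := heV (0, ξ)
    simp only [hV0, shift_zero] at h1
    exact h1

end Main

end HilbertMod

theorem theorem1p1 {A : Type u} [NonUnitalCStarAlgebra A] [PartialOrder A] [StarOrderedRing A]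
    [TopologicalSpace.SeparableSpace A]
    {E : Type v} [NormedAddCommGroup E] [NormedSpace ℂ E] [CompleteSpace E]
    [SMul A E] [CStarModule A E] (hE : HilbertMod.CountablyGenerated A E)
    {d : ℕ} (hd : 1 ≤ d) (V : (Fin d → ℝ≥0) → HilbertMod.Adjointable A E E)
    (hV : HilbertMod.IsIsometricSemigroup V)
    (hcomm : HilbertMod.DoublyCommuting V) (hpure : HilbertMod.StronglyPure V) :
    (∃ (K : Type v) (_ : NormedAddCommGroup K) (_ : NormedSpace ℂ K) (_ : CompleteSpace K)
        (_ : SMul A K) (_ : CStarModule A K)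
        (U : HilbertMod.Adjointable A (HilbertMod.Tensor A (HilbertMod.L2Orthant d) K) E),
      U.IsUnitary ∧
      ∀ (t : Fin d → ℝ≥0) (ξ : E),
        U (HilbertMod.Tensor.isometryTensorOne A K (HilbertMod.shift t) (U.adjoint ξ)) = V t ξ) ∧
    ∀ (z : Fin d → ℂ) (hz : ∀ i, 0 < (z i).re),
      ∃ U : HilbertMod.Adjointable A E
          (HilbertMod.Tensor A (HilbertMod.L2Orthant d) (HilbertMod.eigenmodule V z)),
        U.IsUnitary ∧
        (∀ (t : Fin d → ℝ≥0) (ξ : E),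
          U (V t ξ) = HilbertMod.Tensor.isometryTensorOne A (HilbertMod.eigenmodule V z)
            (HilbertMod.shift t) (U ξ)) ∧
        ∀ ξ : HilbertMod.eigenmodule V z,
          U ξ = HilbertMod.Tensor.tmul A (HilbertMod.expVec z hz) ξ := by
  refine ⟨?_, fun z hz => hV.exists_unitary_shift hcomm hpure hz⟩
  -- Any $z$ with positive real parts would do; $z=(1,\dots,1)$ is chosen, and the adjoint of the
  -- resulting unitary points in the required direction.
  obtain ⟨U, hU, hUV, -⟩ := hV.exists_unitary_shift hcomm hpure (z := fun _ => 1) (by simp)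
  refine ⟨HilbertMod.eigenmodule V fun _ => 1, inferInstance, inferInstance,
    hV.completeSpace_eigenmodule _, inferInstance, inferInstance, U.adjoint, hU.adjoint,
    fun t ξ => ?_⟩
  change U.adjoint (HilbertMod.Tensor.isometryTensorOne A _ (HilbertMod.shift t) (U ξ)) = V t ξ
  rw [← hUV, hU.adjoint_apply_apply]

end
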